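/- **Theorem (Parabolic coordinates).** Let $(\Omega,\mathcal F,\mathbb P)$ be a probability space and let $a_t(x,x+1)=a_t(x+1,x)\colon\Omega\to(0,\infty)$, $t\in\mathbb R$, $x\in\mathbb Z$, be random conductances of the nearest-neighbor edges of $\mathbb Z$ such that, for each $x\in\mathbb Z$, the map $(t,\omega)\mapsto a_t(x,x+1)(\omega)$ is $\mathcal B(\mathbb R)\otimes\mathcal F$-measurable and, for each $\omega$, locally Lebesgue integrable in $t$. Suppose that there are space-time shifts $\tau_{t,x}\colon\Omega\to\Omega$, $t\in\mathbb R$, $x\in\mathbb Z$ (that is, $\tau_{0,0}=\mathrm{id}$ and $\tau_{t+s,x+y}=\tau_{t,x}\circ\tau_{s,y}$), each $\mathcal F$-measurable, with $$a_t(x,x+1)\circ\tau_{s,y}=a_{t+s}(x+y,x+y+1),\qquad t,s\in\mathbb R,\ x,y\in\mathbb Z,$$ and that $\mathbb P$ is invariant and ergodic under $\{\tau_{t,x}\}$, where ergodic means that every $A\in\mathcal F$ with $\tau_{t,x}^{-1}(A)=A$ for all $t,x$ has $\mathbb P(A)\in\{0,1\}$. Suppose moreover that $\mathbb E[a_0(e)]<\infty$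 and $\mathbb E[a_0(e)^{-1}]<\infty$ for some edge $e$ (and hence, by stationarity, every edge). Write $b_t(x):=a_t(x,x+1)$ and $$(L_tf)(x):=\sum_{z=\pm1}a_t(x,x+z)\,[f(x+z)-f(x)],\qquad f\colon\mathbb Z\to\mathbb R.$$ Then there is a family of random variables $\psi(t,x)\colon\Omega\to\mathbb R$, $t\in\mathbb R$, $x\in\mathbb Z$, depending on $\omega$ only through the sample of the conductances, with $(t,\omega)\mapsto\psi(t,x)(\omega)$ jointly measurable for each $x\in\mathbb Z$, such that $$\psi(t,x)\in L^1(\mathbb P)\quad\text{and}\quad\mathbb E\,\psi(t,x)=x,\qquad t\in\mathbb R,\ x\in\mathbb Z,$$ $$\mathbb E\bigl(b_0(0)\,\psi(0,1)^2\bigr)<\infty,$$ and such that the following holds for $\mathbb P$-a.e. $\omega$ (with one null set for all $t,s,x,y$): 1. $\psi$ is a weak solution of $\frac{\partial}{\partial t}\psi(t,x)+L_t\psi(t,x)=0$, $t\in\mathbb R$, $x\in\mathbb Z$; that is, for each $x\in\mathbb Z$ the functions $t\mapsto\psi(t,x)$ and $t\mapsto (L_t\psi(t,\cdot))(x)$ are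 locally integrable and $-\int_{\mathbb R}\psi(t,x)\,\eta'(t)\,dt+\int_{\mathbb R}(L_t\psi(t,\cdot))(x)\,\eta(t)\,dt=0$ for all $\eta\in C_c^\infty(\mathbb R)$. Moreover $\psi(0,0)=0$, and $t\mapsto\psi(t,x)$ is continuous for each $x\in\mathbb Z$. 2. (Cocycle condition) $\psi(t+s,x+y)-\psi(t,x)=\psi(s,y)\circ\tau_{t,x}$ for all $t,s\in\mathbb R$ and $x,y\in\mathbb Z$. 3. (Positive gradients) $\psi(t,x+1)-\psi(t,x)>0$ for all $t\in\mathbb R$ and $x\in\mathbb Z$. -/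

import Mathlib

open MeasureTheory

/-- The generator of the nearest-neighbour walk on `ℤ` with conductances `c x y`:
`(L f)(x) = ∑_{z = ±1} c(x, x+z) [f(x+z) - f(x)]`. -/
def nnGenerator (c : ℤ → ℤ → ℝ) (f : ℤ → ℝ) (x : ℤ) : ℝ :=
  ∑ z ∈ ({1, -1} : Finset ℤ), c x (x + z) * (f (x + z) - f x)

/-- Stationary and ergodic dynamical conductances on the nearest-neighbour edges of `ℤ`.
Here `a t x y ω` is the conductance of the edge `(x, y)` at time `t` in the environment `ω`
(only `y = x ± 1` matters), and `τ t x` is the shift of the environment by the space-time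
vector `(t, x)`. -/
structure IsStationaryErgodicConductance {Ω : Type*} [MeasurableSpace Ω] (P : Measure Ω)
    (a : ℝ → ℤ → ℤ → Ω → ℝ) (τ : ℝ → ℤ → Ω → Ω) : Prop where
  /-- conductances are symmetric -/
  symm : ∀ t x ω, a t x (x + 1) ω = a t (x + 1) x ω
  /-- conductances are positive -/
  pos : ∀ t x ω, 0 < a t x (x + 1) ω
  /-- conductances are jointly measurable in time and the environment -/
  measurable : ∀ x, Measurable fun p : ℝ × Ω => a p.1 x (x + 1) p.2
  /-- conductances are locally Lebesgue integrable in time -/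
  locallyIntegrable : ∀ x ω, LocallyIntegrable (fun t : ℝ => a t x (x + 1) ω) volume
  /-- the space-time shifts form an action of the additive group `ℝ × ℤ` -/
  shift_zero : ∀ ω, τ 0 0 ω = ω
  shift_add : ∀ t s x y ω, τ (t + s) (x + y) ω = τ t x (τ s y ω)
  /-- the shifts act on the conductances by translation in space-time -/
  covariant : ∀ t s x y ω, a t x (x + 1) (τ s y ω) = a (t + s) (x + y) (x + y + 1) ω
  /-- the law of the environment is invariant under the shifts -/
  invariant : ∀ t x, MeasurePreserving (τ t x) P P
  /-- every event invariant under all the shifts is trivial -/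
  ergodic : ∀ A : Set Ω, MeasurableSet A → (∀ t x, τ t x ⁻¹' A = A) → P A = 0 ∨ P A = 1

/-- `u` is a weak solution of `∂u/∂t (t, x) + (L_t u(t, ·))(x) = 0` on `ℝ × ℤ`, where `L_t` is the
generator with conductances `c t`: for every `x`, both `u(·, x)` and `(L_t u(t, ·))(x)` are locally
integrable in `t`, and the distributional time derivative of `u(·, x)` is `-(L_t u(t, ·))(x)`. -/
def IsWeakParabolicSolution (c : ℝ → ℤ → ℤ → ℝ) (u : ℝ → ℤ → ℝ) : Prop :=
  ∀ x : ℤ,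
    LocallyIntegrable (fun t : ℝ => u t x) volume ∧
    LocallyIntegrable (fun t : ℝ => nnGenerator (c t) (u t) x) volume ∧
    ∀ η : ℝ → ℝ, ContDiff ℝ ((⊤ : ℕ∞) : WithTop ℕ∞) η → HasCompactSupport η →
      -(∫ t : ℝ, u t x * deriv η t) + ∫ t : ℝ, nnGenerator (c t) (u t) x * η t = 0

open MeasureTheory

/-! The coordinates are limits of x + φ(t,x) − φ(0,0) with stationary correctors φ. Only the
gradient 1 + ∇φ and the flux need to converge; φ itself may diverge.

Approximation. For conductances truncated to β ≤ n and a mass ε > 0, the equation ∂ₜφ + L(x + φ) =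
εφ is a contractive fixed point problem for a time resolvent, and the iteration preserves 1 + ∇φ ≥ 0
(`exists_bounded_corrector`). Testing with φ and using stationarity in time and space bounds 2ε E φ²
+ E β(1 + ∇φ)² by E β (`energy_estimate`). Gradients and fluxes thus have bounded energy, and with ε
= n⁻² the mass term vanishes in L¹.

Strong limit. Approximate correctors whose flux is exact wherever b ≤ N form nested, midpoint convex
sets. Near minimizers of a quadratic energy on them are Cauchy by the parallelogram identity
(`exists_geometric_near_minimizers`), which replaces weak compactness. The moments of b and b⁻¹ turn
energy distance into L¹ distance, at a geometric rate, so there is almost sure convergence with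
integrable dominating functions. By Fubini this holds along the paths of almost every sample, and
dominated convergence in the integrated equation gives convergence at all (t,x) off one null set
(`exists_limit_of_dominated`). The cocycle property, the sign of the gradients and the means pass to
the limit; Fatou gives the weighted second moment.

Strict positivity. A gradient g of the limit satisfies ∂ₜg ≤ 2bg, so a zero persists forward in
time; the nonnegative terms from the neighbours then force zeros everywhere at later times
(`gradient_eq_zero_of_eq_zero`). Such extinction is a shift-invariant event, of probability 0 or 1
by ergodicity. Probability 1 is impossible: the law of the gradient at time m does not depend on m,
so ψ(0,1) would vanish almost surely although its mean is 1. -/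

namespace ParabolicCoordinates

open Set Filter Topology

/-! ### Calculus of primitives and the time resolvent -/

section

/-- The conductances are merely locally integrable in time, so every evolution equation is kept in
integrated form. Absolute continuity is the regularity in which the product rule survives. -/
theorem absolutelyContinuousOnInterval_of_primitive {u u' : ℝ → ℝ}
    (hu' : ∀ s t, IntervalIntegrable u' volume s t) (hu : ∀ s t, u t - u s = ∫ r in s..t, u' r)
    (s t : ℝ) : AbsolutelyContinuousOnInterval u s t := by
  have h1 := (hu' s t).absolutelyContinuousOnInterval_intervalIntegral (c := s) (by simp)
  have h2 : AbsolutelyContinuousOnInterval (fun _ : ℝ => u s) s t :=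
    ((LipschitzWith.const (u s)).lipschitzOnWith (s := uIcc s t)).absolutelyContinuousOnInterval
  have h3 : u = fun r => u s + ∫ v in s..r, u' v := by
    funext r; rw [← hu s r]; ring
  rw [h3]
  exact h2.add h1

theorem ae_deriv_eq_of_primitive {u u' : ℝ → ℝ}
    (hu' : ∀ s t, IntervalIntegrable u' volume s t) (hu : ∀ s t, u t - u s = ∫ r in s..t, u' r)
    (s t : ℝ) : ∀ᵐ r, r ∈ uIcc s t → deriv u r = u' r := by
  filter_upwards [(hu' s t).ae_hasDerivAt_integral] with r hr hrm
  have h := (hr hrm s (by simp)).const_add (u s)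
  have h3 : u = fun r => u s + ∫ v in s..r, u' v := by
    funext r; rw [← hu s r]; ring
  rw [h3]
  exact h.deriv

theorem continuous_of_primitive {u u' : ℝ → ℝ}
    (hu' : ∀ s t, IntervalIntegrable u' volume s t) (hu : ∀ s t, u t - u s = ∫ r in s..t, u' r) :
    Continuous u := by
  have h3 : u = fun r => u 0 + ∫ v in (0:ℝ)..r, u' v := by
    funext r; rw [← hu 0 r]; ring
  rw [h3]
  exact continuous_const.add (intervalIntegral.continuous_primitive hu' 0)

/-- Product rule for primitives of locally integrable functions. -/
theorem integral_product_rule_of_primitive {u u' v v' : ℝ → ℝ}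
    (hu' : ∀ s t, IntervalIntegrable u' volume s t) (hu : ∀ s t, u t - u s = ∫ r in s..t, u' r)
    (hv' : ∀ s t, IntervalIntegrable v' volume s t) (hv : ∀ s t, v t - v s = ∫ r in s..t, v' r)
    (s t : ℝ) : ∫ r in s..t, (u' r * v r + u r * v' r) = u t * v t - u s * v s := by
  rw [← (absolutelyContinuousOnInterval_of_primitive hu' hu s t).integral_deriv_mul_eq_sub
    (absolutelyContinuousOnInterval_of_primitive hv' hv s t)]
  apply intervalIntegral.integral_congr_ae
  filter_upwards [ae_deriv_eq_of_primitive hu' hu s t, ae_deriv_eq_of_primitive hv' hv s t]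
    with r h1 h2 hr
  rw [h1 (uIoc_subset_uIcc hr), h2 (uIoc_subset_uIcc hr)]

theorem intervalIntegrable_of_bounded {H : ℝ → ℝ} (hm : Measurable H) {M : ℝ}
    (hM : ∀ t, |H t| ≤ M) (s t : ℝ) : IntervalIntegrable H volume s t := by
  rw [intervalIntegrable_iff]
  refine Measure.integrableOn_of_bounded (M := M) (by simp [uIoc]) hm.aestronglyMeasurable ?_
  exact Eventually.of_forall hM

/-- The resolvent `∫₀^∞ e^{-λu} H(t+u) du` of the time translation. -/
noncomputable def timeResolvent (l : ℝ) (H : ℝ → ℝ) (t : ℝ) : ℝ :=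
  ∫ u in Ioi (0 : ℝ), Real.exp (-l * u) * H (t + u)

theorem integrableOn_exp_mul {l : ℝ} (hl : 0 < l) {H : ℝ → ℝ} (hm : Measurable H) {M : ℝ}
    (hM : ∀ t, |H t| ≤ M) (c : ℝ) :
    IntegrableOn (fun u => Real.exp (-l * u) * H u) (Ioi c) := by
  refine Integrable.mul_bdd (c := M) (exp_neg_integrableOn_Ioi c hl) hm.aestronglyMeasurable ?_
  exact Eventually.of_forall hM

theorem integral_exp_neg_mul_Ioi_zero {l : ℝ} (hl : 0 < l) :
    ∫ u in Ioi (0 : ℝ), Real.exp (-l * u) = 1 / l := by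
  rw [integral_exp_mul_Ioi (by linarith) 0]; simp

theorem abs_timeResolvent_le {l : ℝ} (hl : 0 < l) {H : ℝ → ℝ} {M : ℝ}
    (hM : ∀ t, |H t| ≤ M) (t : ℝ) : |timeResolvent l H t| ≤ M / l := by
  unfold timeResolvent
  rw [← Real.norm_eq_abs]
  calc _ ≤ ∫ u in Ioi (0 : ℝ), Real.exp (-l * u) * M := by
        refine norm_integral_le_of_norm_le ((exp_neg_integrableOn_Ioi 0 hl).mul_const M) ?_
        refine Eventually.of_forall fun u => ?_
        rw [norm_mul, Real.norm_eq_abs, Real.abs_exp]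
        exact mul_le_mul_of_nonneg_left (hM _) (Real.exp_pos _).le
    _ = M / l := by
        rw [MeasureTheory.integral_mul_const, integral_exp_neg_mul_Ioi_zero hl]; ring

/-- Translating the variable writes the resolvent R as e^{lt} ∫_t^∞ e^{-lu} H(u) du, and the product
rule then gives R' = lR − H. No continuity of H is needed. -/
theorem timeResolvent_sub {l : ℝ} (hl : 0 < l) {H : ℝ → ℝ} (hm : Measurable H) {M : ℝ}
    (hM : ∀ t, |H t| ≤ M) (s t : ℝ) :
    timeResolvent l H t - timeResolvent l H s
      = ∫ r in s..t, (l * timeResolvent l H r - H r) := by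
  set G : ℝ → ℝ := fun t => ∫ u in Ioi t, Real.exp (-l * u) * H u with hG
  have hR : ∀ t, timeResolvent l H t = Real.exp (l * t) * G t := by
    intro t
    have h1 : G t = ∫ u in Ioi (0:ℝ), Real.exp (-l * (t + u)) * H (t + u) := by
      have h2 := ((measurePreserving_add_left volume t).setIntegral_preimage_emb
        (measurableEmbedding_addLeft t) (fun u => Real.exp (-l * u) * H u) (Ioi t))
      simp only [hG]
      rw [← h2]
      simp
    rw [h1, ← MeasureTheory.integral_const_mul]
    unfold timeResolvent
    congr 1
    funext u
    rw [← mul_assoc, ← Real.exp_add]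
    congr 2; ring
  have hGi : ∀ c, IntegrableOn (fun u => Real.exp (-l * u) * H u) (Ioi c) :=
    integrableOn_exp_mul hl hm hM
  have hii : ∀ s t, IntervalIntegrable (fun u => -(Real.exp (-l * u) * H u)) volume s t := by
    intro s t
    apply IntervalIntegrable.neg
    rw [intervalIntegrable_iff]
    exact (hGi (min s t)).mono_set (by intro x hx; exact hx.1)
  have hGs : ∀ s t, G t - G s = ∫ r in s..t, -(Real.exp (-l * r) * H r) := by
    intro s t
    rw [intervalIntegral.integral_neg]
    have := intervalIntegral.integral_Ioi_sub_Ioi' (hGi s) (hGi t)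
    simp only [hG]
    linarith
  have h := integral_product_rule_of_primitive (u := fun t => Real.exp (l * t))
    (u' := fun t => l * Real.exp (l * t)) (fun s t => Continuous.intervalIntegrable (by fun_prop) _ _)
    (fun s t => by
      symm
      apply intervalIntegral.integral_eq_sub_of_hasDerivAt
      · intro x _
        have := ((hasDerivAt_id x).const_mul l).exp
        simpa [mul_comm] using this
      · exact Continuous.intervalIntegrable (by fun_prop) _ _) hii hGs s t
  rw [hR, hR, ← h]
  apply intervalIntegral.integral_congr
  intro r _
  have : Real.exp (l * r) * Real.exp (-l * r) = 1 := by
    rw [← Real.exp_add]; simp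
  simp only [hR]
  linear_combination (-H r) * this


/-- Testing a primitive against a compactly supported smooth function. -/
theorem integral_mul_deriv_of_primitive {u u' : ℝ → ℝ}
    (hu' : ∀ s t, IntervalIntegrable u' volume s t) (hu : ∀ s t, u t - u s = ∫ r in s..t, u' r)
    {η : ℝ → ℝ} (hη : ContDiff ℝ ((⊤ : ℕ∞) : WithTop ℕ∞) η) (hc : HasCompactSupport η) :
    ∫ t, u t * deriv η t = -∫ t, u' t * η t := by
  obtain ⟨T, hT⟩ : ∃ T : ℝ, tsupport η ⊆ Ioo (-T) T := by
    obtain ⟨R, hR⟩ := hc.isCompact.isBounded.subset_ball 0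
    exact ⟨R, by simpa [Real.ball_eq_Ioo] using hR⟩
  have hd : Continuous (deriv η) := hη.continuous_deriv (by simp)
  have hη0 : ∀ t, t ∉ Ioo (-T) T → η t = 0 := fun t ht =>
    image_eq_zero_of_notMem_tsupport fun h => ht (hT h)
  have hd0 : ∀ t, t ∉ Ioo (-T) T → deriv η t = 0 := fun t ht =>
    Function.notMem_support.1 fun h => ht (hT (support_deriv_subset h))
  have key := integral_product_rule_of_primitive hu' hu (v := η) (v' := deriv η)
    (fun s t => hd.intervalIntegrable _ _)
    (fun s t => by
      symm
      exact intervalIntegral.integral_deriv_eq_sub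
        (fun x _ => (hη.differentiable (by simp)) x) (hd.intervalIntegrable _ _)) (-T) T
  rw [hη0 T (by simp), hη0 (-T) (by simp)] at key
  have hfull : ∀ w : ℝ → ℝ, (∀ t, t ∉ Ioo (-T) T → w t = 0) → ∫ t, w t = ∫ t in (-T)..T, w t := by
    intro w hw
    rw [intervalIntegral.integral_eq_integral_of_support_subset]
    intro t ht
    by_contra h
    exact ht (hw t fun h' => h (Ioo_subset_Ioc_self h'))
  rw [hfull _ (fun t ht => by rw [hd0 t ht, mul_zero]), hfull _ (fun t ht => by rw [hη0 t ht, mul_zero])]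
  rw [intervalIntegral.integral_add] at key
  · linarith
  · exact (hu' _ _).mul_continuousOn hη.continuous.continuousOn
  · exact (hd.intervalIntegrable _ _).continuousOn_mul (continuous_of_primitive hu' hu).continuousOn

/-- A nonnegative continuous function satisfying `g(t) - g(s) ≤ ∫ b g` stays zero once it is zero. -/
theorem eq_zero_of_integral_le {g b : ℝ → ℝ} (hg : Continuous g) (hg0 : ∀ t, 0 ≤ g t)
    (hb0 : ∀ t, 0 ≤ b t) (hb : ∀ s t, IntervalIntegrable b volume s t)
    (hle : ∀ s t, s ≤ t → g t - g s ≤ ∫ r in s..t, b r * g r) {t₀ : ℝ} (h0 : g t₀ = 0)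
    {t : ℝ} (ht : t₀ ≤ t) : g t = 0 := by
  have key : Icc t₀ t ⊆ {r | g r = 0} := by
    apply IsClosed.Icc_subset_of_forall_exists_gt
    · exact (isClosed_eq hg continuous_const).inter isClosed_Icc
    · exact h0
    · rintro x ⟨hx0, hx1, hx2⟩ y hy
      have hcont : Continuous fun z => ∫ r in x..z, b r := intervalIntegral.continuous_primitive hb x
      -- On an interval starting at a zero where b has mass below 1/2, the maximum of g is at most
      -- half of itself, hence zero. This moves the zero set to the right.
      have hev : ∀ᶠ z in 𝓝[>] x, ∫ r in x..z, b r < 1 / 2 := by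
        apply nhdsWithin_le_nhds
        apply hcont.continuousAt.eventually_lt continuousAt_const
        simp
      have hev2 : ∀ᶠ z in 𝓝[>] x, z ∈ Ioc x y := Ioc_mem_nhdsGT hy
      obtain ⟨z, hz1, hz2⟩ := (hev.and hev2).exists
      refine ⟨z, ?_, hz2⟩
      obtain ⟨m, hm, hmax⟩ := isCompact_Icc.exists_isMaxOn (nonempty_Icc.2 hz2.1.le) hg.continuousOn
      have hx0' : g x = 0 := hx0
      have h1 : g m ≤ ∫ r in x..m, b r * g r := by
        have := hle x m hm.1
        rwa [hx0', sub_zero] at this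
      have h2 : ∫ r in x..m, b r * g r ≤ ∫ r in x..m, b r * g m := by
        apply intervalIntegral.integral_mono_on hm.1
        · exact (hb _ _).mul_continuousOn hg.continuousOn
        · exact (hb _ _).mul_const _
        · intro r hr
          exact mul_le_mul_of_nonneg_left (hmax ⟨hr.1, hr.2.trans hm.2⟩) (hb0 r)
      rw [intervalIntegral.integral_mul_const] at h2
      have h3 : ∫ r in x..m, b r ≤ ∫ r in x..z, b r := by
        apply intervalIntegral.integral_mono_interval le_rfl hm.1 hm.2
        · exact Eventually.of_forall hb0
        · exact hb _ _
      have h4 : g m = 0 := by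
        have := hg0 m
        nlinarith
      have h5 : g z ≤ g m := hmax ⟨hz2.1.le, le_rfl⟩
      exact le_antisymm (h4 ▸ h5) (hg0 z)
  exact key ⟨ht, le_rfl⟩

end

/-! ### Stationary fields and the massive corrector for bounded conductances -/

section

theorem timeResolvent_sub_fun {l : ℝ} (hl : 0 < l) {H H' : ℝ → ℝ} (hm : Measurable H)
    (hm' : Measurable H') {M M' : ℝ} (hM : ∀ t, |H t| ≤ M) (hM' : ∀ t, |H' t| ≤ M') (t : ℝ) :
    timeResolvent l (fun r => H r - H' r) t = timeResolvent l H t - timeResolvent l H' t := by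
  unfold timeResolvent
  rw [← MeasureTheory.integral_sub]
  · congr 1; funext u; ring
  · exact integrableOn_exp_mul hl (H := fun u => H (t + u)) (by fun_prop) (fun u => hM _) 0
  · exact integrableOn_exp_mul hl (H := fun u => H' (t + u)) (by fun_prop) (fun u => hM' _) 0

/-- The resolvent is order preserving and sends the constant −l to −1. This carries the bound ∇φ ≥
−1 through the iteration. -/
theorem neg_one_le_timeResolvent {l : ℝ} (hl : 0 < l) {H : ℝ → ℝ} (hm : Measurable H)
    {M : ℝ} (hM : ∀ t, |H t| ≤ M) (h : ∀ t, -l ≤ H t) (t : ℝ) : -1 ≤ timeResolvent l H t := by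
  have h1 : ∫ u in Ioi (0 : ℝ), Real.exp (-l * u) * (-l) = -1 := by
    rw [MeasureTheory.integral_mul_const, integral_exp_neg_mul_Ioi_zero hl]
    field_simp
  rw [← h1]
  apply integral_mono
  · exact (exp_neg_integrableOn_Ioi 0 hl).mul_const _
  · exact integrableOn_exp_mul hl (H := fun u => H (t + u)) (by fun_prop) (fun u => hM _) 0
  · intro u
    exact mul_le_mul_of_nonneg_left (h _) (Real.exp_pos _).le

variable {Ω : Type*}

/-- The gradient `1 + ∇φ` of the function `x + φ(x)`. -/
def tiltedGradient (φ : ℝ → ℤ → Ω → ℝ) (t : ℝ) (x : ℤ) (ω : Ω) : ℝ :=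
  1 + φ t (x + 1) ω - φ t x ω

/-- The flux `β (1 + ∇φ)` of the function `x + φ(x)`. -/
def flux (β φ : ℝ → ℤ → Ω → ℝ) (t : ℝ) (x : ℤ) (ω : Ω) : ℝ :=
  β t x ω * tiltedGradient φ t x ω

/-- The right-hand side `C φ + L(x + φ)` of the fixed point equation. -/
def source (C : ℝ) (β φ : ℝ → ℤ → Ω → ℝ) (t : ℝ) (x : ℤ) (ω : Ω) : ℝ :=
  C * φ t x ω + (flux β φ t x ω - flux β φ t (x + -1) ω)

/-- The choice C = 2n makes all coefficients of the differences, namely n − β (twice) and β (twice,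
at the two edges), nonnegative. They sum to 2n, which is therefore the Lipschitz constant in the
supremum norm. -/
theorem source_sub_le {n : ℝ} {β φ φ' : ℝ → ℤ → Ω → ℝ} (hβ0 : ∀ t x ω, 0 ≤ β t x ω)
    (hβn : ∀ t x ω, β t x ω ≤ n) {D : ℝ} (hD : ∀ t x ω, |φ t x ω - φ' t x ω| ≤ D)
    (t : ℝ) (x : ℤ) (ω : Ω) :
    |source (2 * n) β φ t x ω - source (2 * n) β φ' t x ω| ≤ 2 * n * D := by
  have e : source (2 * n) β φ t x ω - source (2 * n) β φ' t x ω =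
      (n - β t x ω) * (φ t x ω - φ' t x ω)
        + (n - β t (x + -1) ω) * (φ t x ω - φ' t x ω)
        + β t x ω * (φ t (x + 1) ω - φ' t (x + 1) ω)
        + β t (x + -1) ω * (φ t (x + -1) ω - φ' t (x + -1) ω) := by
    unfold source flux tiltedGradient
    rw [show x + -1 + 1 = x by ring]
    ring
  have m1 := abs_le.1 (hD t x ω)
  have m2 := abs_le.1 (hD t (x + 1) ω)
  have m3 := abs_le.1 (hD t (x + -1) ω)
  have a1 := hβ0 t x ω
  have a2 := hβ0 t (x + -1) ω
  have a3 := sub_nonneg.2 (hβn t x ω)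
  have a4 := sub_nonneg.2 (hβn t (x + -1) ω)
  rw [e, abs_le]
  constructor
  · linarith [mul_le_mul_of_nonneg_left m1.1 a3, mul_le_mul_of_nonneg_left m1.1 a4,
      mul_le_mul_of_nonneg_left m2.1 a1, mul_le_mul_of_nonneg_left m3.1 a2]
  · linarith [mul_le_mul_of_nonneg_left m1.2 a3, mul_le_mul_of_nonneg_left m1.2 a4,
      mul_le_mul_of_nonneg_left m2.2 a1, mul_le_mul_of_nonneg_left m3.2 a2]

theorem abs_source_le {n : ℝ} {β φ : ℝ → ℤ → Ω → ℝ} (hβ0 : ∀ t x ω, 0 ≤ β t x ω)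
    (hβn : ∀ t x ω, β t x ω ≤ n) {D : ℝ} (hD : ∀ t x ω, |φ t x ω| ≤ D)
    (t : ℝ) (x : ℤ) (ω : Ω) :
    |source (2 * n) β φ t x ω| ≤ 2 * n * D + n := by
  have h := source_sub_le (φ' := fun _ _ _ => 0) hβ0 hβn (by simpa using hD) t x ω
  have h0 : |source (2 * n) β (fun _ _ _ => 0) t x ω| ≤ n := by
    simp only [source, flux, tiltedGradient]
    rw [abs_le]
    constructor <;> linarith [hβ0 t x ω, hβ0 t (x + -1) ω, hβn t x ω, hβn t (x + -1) ω]
  have := abs_sub_abs_le_abs_sub (source (2 * n) β φ t x ω) (source (2 * n) β (fun _ _ _ => 0) t x ω)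
  linarith

variable [MeasurableSpace Ω]

/-- A space-time random field that is jointly measurable, moves along with the shifts `τ`, and is
a function of the sample of the field `b`. -/
structure IsStationaryField (b : ℝ → ℤ → Ω → ℝ) (τ : ℝ → ℤ → Ω → Ω) (f : ℝ → ℤ → Ω → ℝ) :
    Prop where
  measurable : ∀ x, Measurable fun p : ℝ × Ω => f p.1 x p.2
  shift : ∀ t s x y ω, f t x (τ s y ω) = f (t + s) (x + y) ω
  factor : ∀ ω ω', (∀ t x, b t x ω = b t x ω') → ∀ t x, f t x ω = f t x ω'

namespace IsStationaryField

variable {b : ℝ → ℤ → Ω → ℝ} {τ : ℝ → ℤ → Ω → Ω} {f g : ℝ → ℤ → Ω → ℝ}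

theorem const (c : ℝ) : IsStationaryField b τ fun _ _ _ => c :=
  ⟨fun _ => measurable_const, fun _ _ _ _ _ => rfl, fun _ _ _ _ _ => rfl⟩

theorem map (hf : IsStationaryField b τ f) {h : ℝ → ℝ} (hh : Measurable h) :
    IsStationaryField b τ fun t x ω => h (f t x ω) :=
  ⟨fun x => hh.comp (hf.measurable x), fun t s x y ω => by rw [hf.shift],
    fun ω ω' h t x => by rw [hf.factor ω ω' h]⟩

theorem add (hf : IsStationaryField b τ f) (hg : IsStationaryField b τ g) :
    IsStationaryField b τ fun t x ω => f t x ω + g t x ω :=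
  ⟨fun x => (hf.measurable x).add (hg.measurable x),
    fun t s x y ω => by rw [hf.shift, hg.shift],
    fun ω ω' h t x => by rw [hf.factor ω ω' h, hg.factor ω ω' h]⟩

theorem sub (hf : IsStationaryField b τ f) (hg : IsStationaryField b τ g) :
    IsStationaryField b τ fun t x ω => f t x ω - g t x ω :=
  ⟨fun x => (hf.measurable x).sub (hg.measurable x),
    fun t s x y ω => by rw [hf.shift, hg.shift],
    fun ω ω' h t x => by rw [hf.factor ω ω' h, hg.factor ω ω' h]⟩

theorem mul (hf : IsStationaryField b τ f) (hg : IsStationaryField b τ g) :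
    IsStationaryField b τ fun t x ω => f t x ω * g t x ω :=
  ⟨fun x => (hf.measurable x).mul (hg.measurable x),
    fun t s x y ω => by rw [hf.shift, hg.shift],
    fun ω ω' h t x => by rw [hf.factor ω ω' h, hg.factor ω ω' h]⟩

theorem translate (hf : IsStationaryField b τ f) (k : ℤ) :
    IsStationaryField b τ fun t x ω => f t (x + k) ω :=
  ⟨fun x => hf.measurable (x + k),
    fun t s x y ω => by rw [hf.shift, add_right_comm],
    fun ω ω' h t x => hf.factor ω ω' h _ _⟩

theorem of_tendsto {F : ℕ → ℝ → ℤ → Ω → ℝ} (hF : ∀ n, IsStationaryField b τ (F n))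
    (hlim : ∀ t x ω, Tendsto (fun n => F n t x ω) atTop (𝓝 (f t x ω))) :
    IsStationaryField b τ f :=
  ⟨fun x => measurable_of_tendsto_metrizable (fun n => (hF n).measurable x)
      (tendsto_pi_nhds.2 fun p => hlim p.1 x p.2),
    fun t s x y ω => by
      refine tendsto_nhds_unique (hlim t x (τ s y ω)) ?_
      simp_rw [(hF _).shift]
      exact hlim _ _ _,
    fun ω ω' h t x => by
      refine tendsto_nhds_unique (hlim t x ω) ?_
      simp_rw [(hF _).factor ω ω' h]
      exact hlim _ _ _⟩

theorem resolvent (hf : IsStationaryField b τ f) (l : ℝ) :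
    IsStationaryField b τ fun t x ω => timeResolvent l (fun r => f r x ω) t := by
  refine ⟨fun x => ?_, fun t s x y ω => ?_, fun ω ω' h t x => ?_⟩
  · unfold timeResolvent
    have hm : Measurable fun q : (ℝ × Ω) × ℝ => Real.exp (-l * q.2) * f (q.1.1 + q.2) x q.1.2 := by
      refine Measurable.mul (by fun_prop) ?_
      exact (hf.measurable x).comp (g := fun p : ℝ × Ω => f p.1 x p.2)
        (f := fun q : (ℝ × Ω) × ℝ => (q.1.1 + q.2, q.1.2)) (by fun_prop)
    exact (hm.stronglyMeasurable.integral_prod_right').measurable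
  · unfold timeResolvent
    congr 1; funext u
    simp only [hf.shift, add_right_comm]
  · unfold timeResolvent
    congr 1; funext u
    simp only [hf.factor ω ω' h]

theorem measurable_path (hf : IsStationaryField b τ f) (x : ℤ) (ω : Ω) :
    Measurable fun t => f t x ω :=
  (hf.measurable x).comp (measurable_id.prodMk measurable_const)

theorem measurable_at (hf : IsStationaryField b τ f) (t : ℝ) (x : ℤ) : Measurable (f t x) :=
  (hf.measurable x).comp (measurable_const.prodMk measurable_id)

theorem eq_comp (hf : IsStationaryField b τ f) (t : ℝ) (x : ℤ) : f t x = f 0 0 ∘ τ t x := by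
  funext ω
  simp [hf.shift]

variable {P : Measure Ω}

theorem integral_eq (hf : IsStationaryField b τ f) (hτ : ∀ t x, MeasurePreserving (τ t x) P P)
    (t : ℝ) (x : ℤ) : ∫ ω, f t x ω ∂P = ∫ ω, f 0 0 ω ∂P := by
  rw [hf.eq_comp t x]
  have := integral_map (μ := P) (hτ t x).measurable.aemeasurable (f := f 0 0)
    (hf.measurable_at 0 0).aestronglyMeasurable
  rw [(hτ t x).map_eq] at this
  exact this.symm

theorem integrable (hf : IsStationaryField b τ f) (hτ : ∀ t x, MeasurePreserving (τ t x) P P)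
    (h0 : Integrable (f 0 0) P) (t : ℝ) (x : ℤ) : Integrable (f t x) P := by
  rw [hf.eq_comp t x]
  exact (hτ t x).integrable_comp_of_integrable h0

theorem integrable_prod [SFinite P] (hf : IsStationaryField b τ f)
    (hτ : ∀ t x, MeasurePreserving (τ t x) P P)
    (h0 : Integrable (f 0 0) P) (s t : ℝ) (x : ℤ) :
    Integrable (fun p : ℝ × Ω => f p.1 x p.2) ((volume.restrict (Ioc s t)).prod P) := by
  rw [integrable_prod_iff (hf.measurable x).aestronglyMeasurable]
  refine ⟨Eventually.of_forall fun r => hf.integrable hτ h0 r x, ?_⟩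
  have : (fun r => ∫ ω, ‖f r x ω‖ ∂P) = fun _ => ∫ ω, ‖f 0 0 ω‖ ∂P := by
    funext r
    exact (hf.map (h := fun y => ‖y‖) measurable_norm).integral_eq hτ r x
  simp only [this]
  exact integrable_const _

end IsStationaryField

section Corrector

variable {b : ℝ → ℤ → Ω → ℝ} {τ : ℝ → ℤ → Ω → Ω}

theorem IsStationaryField.tiltedGradient {φ : ℝ → ℤ → Ω → ℝ} (hφ : IsStationaryField b τ φ) :
    IsStationaryField b τ (tiltedGradient φ) :=
  ((IsStationaryField.const 1).add (hφ.translate 1)).sub hφ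

theorem IsStationaryField.flux {β φ : ℝ → ℤ → Ω → ℝ} (hβ : IsStationaryField b τ β)
    (hφ : IsStationaryField b τ φ) : IsStationaryField b τ (flux β φ) :=
  hβ.mul hφ.tiltedGradient

theorem IsStationaryField.source {β φ : ℝ → ℤ → Ω → ℝ} (hβ : IsStationaryField b τ β)
    (hφ : IsStationaryField b τ φ) (C : ℝ) : IsStationaryField b τ (source C β φ) :=
  ((IsStationaryField.const C).mul hφ).add ((hβ.flux hφ).sub ((hβ.flux hφ).translate (-1)))

/-- Iterates of the fixed point equation `φ = R (C φ + L (x + φ))`. -/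
noncomputable def correctorIter (n ε : ℝ) (β : ℝ → ℤ → Ω → ℝ) : ℕ → ℝ → ℤ → Ω → ℝ
  | 0 => fun _ _ _ => 0
  | k + 1 => fun t x ω =>
      timeResolvent (2 * n + ε) (fun r => source (2 * n) β (correctorIter n ε β k) r x ω) t

theorem correctorIter_stationary {n ε : ℝ} {β : ℝ → ℤ → Ω → ℝ} (hβ : IsStationaryField b τ β)
    (k : ℕ) : IsStationaryField b τ (correctorIter n ε β k) := by
  induction k with
  | zero => exact IsStationaryField.const 0
  | succ k ih => exact (hβ.source ih _).resolvent _

/-- For bounded conductances and a positive mass `ε`, the massive corrector equation has a bounded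
stationary solution, whose gradients are at least `-1`. -/
theorem exists_bounded_corrector {n ε : ℝ} (hn : 0 < n) (hε : 0 < ε) {β : ℝ → ℤ → Ω → ℝ}
    (hβ : IsStationaryField b τ β) (hβ0 : ∀ t x ω, 0 ≤ β t x ω) (hβn : ∀ t x ω, β t x ω ≤ n) :
    ∃ φ : ℝ → ℤ → Ω → ℝ, IsStationaryField b τ φ ∧ (∃ M, ∀ t x ω, |φ t x ω| ≤ M) ∧
      (∀ t x ω, 0 ≤ tiltedGradient φ t x ω) ∧
      ∀ s t x ω, φ t x ω - φ s x ω = ∫ r in s..t,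
        (ε * φ r x ω - flux β φ r x ω + flux β φ r (x + -1) ω) := by
  -- Adding 2nφ to both sides of the massive equation gives φ = R_l(2nφ + L(x + φ)). Since R_l has
  -- norm 1/l, the contraction factor is 2n/(2n + ε) < 1.
  set l := 2 * n + ε with hl_def
  have hl : 0 < l := by positivity
  set F := correctorIter n ε β with hF
  have hFst : ∀ k, IsStationaryField b τ (F k) := correctorIter_stationary hβ
  have hFsucc : ∀ k t x ω, F (k + 1) t x ω
      = timeResolvent l (fun r => source (2 * n) β (F k) r x ω) t := fun _ _ _ _ => rfl
  have hFb : ∀ k, ∃ M, ∀ t x ω, |F k t x ω| ≤ M := by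
    intro k
    induction k with
    | zero => exact ⟨0, fun t x ω => by simp [hF, correctorIter]⟩
    | succ k ih =>
      obtain ⟨M, hM⟩ := ih
      exact ⟨_, fun t x ω =>
        abs_timeResolvent_le hl (fun r => abs_source_le hβ0 hβn hM r x ω) t⟩
  have hres : ∀ {φ φ' : ℝ → ℤ → Ω → ℝ} {D M M' : ℝ}, IsStationaryField b τ φ →
      IsStationaryField b τ φ' → (∀ t x ω, |φ t x ω| ≤ M) → (∀ t x ω, |φ' t x ω| ≤ M') →
      (∀ t x ω, |φ t x ω - φ' t x ω| ≤ D) → ∀ t x ω,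
      |timeResolvent l (fun r => source (2 * n) β φ r x ω) t
        - timeResolvent l (fun r => source (2 * n) β φ' r x ω) t| ≤ 2 * n / l * D := by
    intro φ φ' D M M' hφ hφ' hM hM' hD t x ω
    rw [← timeResolvent_sub_fun hl ((hβ.source hφ _).measurable_path x ω)
      ((hβ.source hφ' _).measurable_path x ω) (fun r => abs_source_le hβ0 hβn hM r x ω)
      (fun r => abs_source_le hβ0 hβn hM' r x ω)]
    refine (abs_timeResolvent_le hl (fun r => source_sub_le hβ0 hβn hD r x ω) t).trans_eq ?_
    ring
  set q := 2 * n / l with hq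
  have hq0 : 0 ≤ q := by positivity
  have hq1 : q < 1 := by rw [hq, div_lt_one hl]; linarith
  obtain ⟨M₁, hM₁⟩ := hFb 1
  have hgeo : ∀ k t x ω, |F (k + 1) t x ω - F k t x ω| ≤ M₁ * q ^ k := by
    intro k
    induction k with
    | zero => intro t x ω; simpa [hF, correctorIter] using hM₁ t x ω
    | succ k ih =>
      intro t x ω
      obtain ⟨A, hA⟩ := hFb (k + 1)
      obtain ⟨A', hA'⟩ := hFb k
      have := hres (hFst (k + 1)) (hFst k) hA hA' ih t x ω
      rw [hFsucc (k + 1), hFsucc k]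
      refine this.trans_eq ?_
      rw [pow_succ]; ring
  have hdist : ∀ t x ω k, dist (F k t x ω) (F (k + 1) t x ω) ≤ M₁ * q ^ k := by
    intro t x ω k
    rw [dist_comm]; exact hgeo k t x ω
  have hex : ∀ t x ω, ∃ y, Tendsto (fun k => F k t x ω) atTop (𝓝 y) := fun t x ω =>
    cauchySeq_tendsto_of_complete (cauchySeq_of_le_geometric q M₁ hq1 (hdist t x ω))
  choose φ hφ using hex
  have hφst : IsStationaryField b τ φ := IsStationaryField.of_tendsto hFst hφ
  have hclose : ∀ k t x ω, |F k t x ω - φ t x ω| ≤ M₁ * q ^ k / (1 - q) := fun k t x ω =>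
    dist_le_of_le_geometric_of_tendsto q M₁ hq1 (hdist t x ω) (hφ t x ω) k
  have hφb : ∀ t x ω, |φ t x ω| ≤ M₁ / (1 - q) := by
    intro t x ω
    have := hclose 0 t x ω
    simpa [hF, correctorIter] using this
  have hfix : ∀ t x ω, φ t x ω = timeResolvent l (fun r => source (2 * n) β φ r x ω) t := by
    intro t x ω
    have h1 := (hφ t x ω).comp (tendsto_add_atTop_nat 1)
    refine tendsto_nhds_unique h1 ?_
    rw [tendsto_iff_dist_tendsto_zero]
    have h2 : Tendsto (fun k => q * (M₁ * q ^ k / (1 - q))) atTop (𝓝 0) := by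
      have := (((tendsto_pow_atTop_nhds_zero_of_lt_one hq0 hq1).const_mul M₁).div_const
        (1 - q)).const_mul q
      simpa using this
    refine squeeze_zero (fun _ => dist_nonneg) (fun k => ?_) h2
    obtain ⟨A, hA⟩ := hFb k
    exact hres (hFst k) hφst hA hφb (hclose k) t x ω
  refine ⟨φ, hφst, ⟨_, hφb⟩, ?_, ?_⟩
  · have hpos : ∀ k t x ω, 0 ≤ 1 + F k t (x + 1) ω - F k t x ω := by
      intro k
      induction k with
      | zero => intro t x ω; simp [hF, correctorIter]
      | succ k ih =>
        intro t x ω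
        obtain ⟨A, hA⟩ := hFb k
        have hb1 := fun r => abs_source_le hβ0 hβn hA r (x + 1) ω
        have hb2 := fun r => abs_source_le hβ0 hβn hA r x ω
        have hm1 := (hβ.source (hFst k) (2 * n)).measurable_path (x + 1) ω
        have hm2 := (hβ.source (hFst k) (2 * n)).measurable_path x ω
        have := neg_one_le_timeResolvent hl (hm1.sub hm2)
          (M := (2 * n * A + n) + (2 * n * A + n))
          (fun r => (abs_sub _ _).trans (add_le_add (hb1 r) (hb2 r))) (fun r => ?_) t
        · have e := timeResolvent_sub_fun hl hm1 hm2 hb1 hb2 t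
          rw [hFsucc, hFsucc]
          change -1 ≤ timeResolvent l (fun r => source (2 * n) β (F k) r (x + 1) ω -
            source (2 * n) β (F k) r x ω) t at this
          linarith
        -- With G = 1 + ∇φ, the gradient of the source is −2n + 2(n − β(x))G(x) + β(x+1)G(x+1) +
        -- β(x−1)G(x−1), which is at least −2n ≥ −l when G ≥ 0.
        · simp only [source, flux, tiltedGradient, Pi.sub_apply]
          rw [show x + 1 + -1 = x by ring]
          have e1 := mul_nonneg (hβ0 r (x + 1) ω) (ih r (x + 1) ω)
          have e2 := mul_nonneg (hβ0 r (x + -1) ω) (ih r (x + -1) ω)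
          have e3 := mul_nonneg (sub_nonneg.2 (hβn r x ω)) (ih r x ω)
          rw [show x + -1 + 1 = x by ring] at e2 ⊢
          linarith
    intro t x ω
    refine ge_of_tendsto' (x := atTop) ?_ (fun k => hpos k t x ω)
    exact ((hφ t (x + 1) ω).const_add 1).sub (hφ t x ω)
  · intro s t x ω
    rw [hfix t, hfix s, timeResolvent_sub hl ((hβ.source hφst _).measurable_path x ω)
      (fun r => abs_source_le hβ0 hβn hφb r x ω)]
    apply intervalIntegral.integral_congr
    intro r _
    simp only
    rw [← hfix]
    simp only [source, hl_def]
    ring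

end Corrector

end

/-! ### Energy estimate and approximate correctors -/

section

variable {Ω : Type*}

theorem abs_tiltedGradient_le {φ : ℝ → ℤ → Ω → ℝ} {M : ℝ} (hM : ∀ t x ω, |φ t x ω| ≤ M)
    (t : ℝ) (x : ℤ) (ω : Ω) : |tiltedGradient φ t x ω| ≤ 1 + 2 * M := by
  have h1 := abs_le.1 (hM t x ω)
  have h2 := abs_le.1 (hM t (x + 1) ω)
  rw [tiltedGradient, abs_le]
  constructor <;> linarith

variable [MeasurableSpace Ω]

theorem IsStationaryField.integral_intervalIntegral {P : Measure Ω} [SFinite P]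
    {b f : ℝ → ℤ → Ω → ℝ} {τ : ℝ → ℤ → Ω → Ω} (hf : IsStationaryField b τ f)
    (hτ : ∀ t x, MeasurePreserving (τ t x) P P) (h0 : Integrable (f 0 0) P) {s t : ℝ}
    (hst : s ≤ t) (x : ℤ) :
    ∫ ω, (∫ r in s..t, f r x ω) ∂P = (t - s) * ∫ ω, f 0 0 ω ∂P := by
  simp_rw [intervalIntegral.integral_of_le hst]
  rw [← integral_integral_swap (f := fun r ω => f r x ω) (hf.integrable_prod hτ h0 s t x)]
  simp_rw [hf.integral_eq hτ]
  simp [hst]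

theorem IsStationaryField.integrable_of_bounded {P : Measure Ω} [IsFiniteMeasure P]
    {b f : ℝ → ℤ → Ω → ℝ} {τ : ℝ → ℤ → Ω → Ω} (hf : IsStationaryField b τ f)
    {M : ℝ} (hM : ∀ t x ω, |f t x ω| ≤ M) (t : ℝ) (x : ℤ) : Integrable (f t x) P :=
  Integrable.of_bound (hf.measurable_at t x).aestronglyMeasurable M
    (Eventually.of_forall fun ω => hM t x ω)

/-- Energy estimate for the massive corrector equation. -/
theorem energy_estimate {P : Measure Ω} [IsProbabilityMeasure P]
    {b β φ : ℝ → ℤ → Ω → ℝ} {τ : ℝ → ℤ → Ω → Ω}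
    (hτ : ∀ t x, MeasurePreserving (τ t x) P P)
    {n ε M : ℝ} (hβ : IsStationaryField b τ β) (hβ0 : ∀ t x ω, 0 ≤ β t x ω)
    (hβn : ∀ t x ω, β t x ω ≤ n) (hφ : IsStationaryField b τ φ) (hM : ∀ t x ω, |φ t x ω| ≤ M)
    (heq : ∀ s t x ω, φ t x ω - φ s x ω = ∫ r in s..t,
        (ε * φ r x ω - flux β φ r x ω + flux β φ r (x + -1) ω)) :
    2 * (ε * ∫ ω, φ 0 0 ω ^ 2 ∂P) + ∫ ω, β 0 0 ω * tiltedGradient φ 0 0 ω ^ 2 ∂P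
      ≤ ∫ ω, β 0 0 ω ∂P := by
  have hβa : ∀ t x ω, |β t x ω| ≤ n := fun t x ω => by
    rw [abs_of_nonneg (hβ0 t x ω)]; exact hβn t x ω
  have hG := hφ.tiltedGradient
  have hGb := abs_tiltedGradient_le hM
  have hF := hβ.flux hφ
  have hFb : ∀ t x ω, |flux β φ t x ω| ≤ n * (1 + 2 * M) := fun t x ω => by
    rw [flux, abs_mul]
    exact mul_le_mul (hβa t x ω) (hGb t x ω) (abs_nonneg _) ((abs_nonneg _).trans (hβa t x ω))
  have hh : IsStationaryField b τ
      (fun t x ω => ε * φ t x ω - flux β φ t x ω + flux β φ t (x + -1) ω) :=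
    (((IsStationaryField.const ε).mul hφ).sub hF).add (hF.translate (-1))
  have hhb : ∀ t x ω, |ε * φ t x ω - flux β φ t x ω + flux β φ t (x + -1) ω|
      ≤ |ε| * M + n * (1 + 2 * M) + n * (1 + 2 * M) := fun t x ω => by
    refine (abs_add_le _ _).trans (add_le_add ((abs_sub _ _).trans (add_le_add ?_ (hFb _ _ _)))
      (hFb _ _ _))
    rw [abs_mul]
    exact mul_le_mul_of_nonneg_left (hM _ _ _) (abs_nonneg _)
  have hmulb : ∀ {u v : ℝ → ℤ → Ω → ℝ} {A B : ℝ}, (∀ t x ω, |u t x ω| ≤ A) →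
      (∀ t x ω, |v t x ω| ≤ B) → ∀ t x ω, |u t x ω * v t x ω| ≤ A * B := by
    intro u v A B hu hv t x ω
    rw [abs_mul]
    exact mul_le_mul (hu t x ω) (hv t x ω) (abs_nonneg _) ((abs_nonneg _).trans (hu t x ω))
  have hφh := hφ.mul hh
  have hφhi := hφh.integrable_of_bounded (P := P) (hmulb hM hhb) 0 0
  have hpath : ∀ ω, ∫ r in (0:ℝ)..1,
      (φ r 0 ω * (ε * φ r 0 ω - flux β φ r 0 ω + flux β φ r (0 + -1) ω))
      = (φ 1 0 ω ^ 2 - φ 0 0 ω ^ 2) / 2 := by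
    intro ω
    have hii := fun s t => intervalIntegrable_of_bounded (hh.measurable_path 0 ω)
      (fun r => hhb r 0 ω) s t
    have := integral_product_rule_of_primitive hii (fun s t => heq s t 0 ω) hii
      (fun s t => heq s t 0 ω) 0 1
    rw [pow_two, pow_two, ← this, eq_div_iff two_ne_zero, ← intervalIntegral.integral_mul_const]
    congr 1; funext r; ring
  have hφ2 := hφ.mul hφ
  have hφ2i := fun t => hφ2.integrable_of_bounded (P := P) (hmulb hM hM) t 0
  -- Along each path the integrand is half the time derivative of φ², and the mean of φ² is constant
  -- in time.
  have hzero : ∫ ω, φ 0 0 ω * (ε * φ 0 0 ω - flux β φ 0 0 ω + flux β φ 0 (0 + -1) ω) ∂P = 0 := by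
    have h1 := hφh.integral_intervalIntegral hτ hφhi zero_le_one 0
    simp_rw [hpath] at h1
    rw [MeasureTheory.integral_div] at h1
    have h2 : ∫ ω, (φ 1 0 ω ^ 2 - φ 0 0 ω ^ 2) ∂P = 0 := by
      simp_rw [pow_two]
      rw [MeasureTheory.integral_sub (hφ2i 1) (hφ2i 0), hφ2.integral_eq hτ 1 0, sub_self]
    rw [h2] at h1
    simpa using h1.symm
  have hφF := hφ.mul hF
  have hφFi := hφF.integrable_of_bounded (P := P) (hmulb hM hFb) 0 0
  have hφ'F := (hφ.translate 1).mul hF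
  have hφ'Fb := hmulb (u := fun t x ω => φ t (x + 1) ω) (fun t x ω => hM t (x + 1) ω) hFb
  have hφ'Fi := hφ'F.integrable_of_bounded (P := P) hφ'Fb
  -- Summation by parts in space is invariance under the unit shift.
  have hback : ∫ ω, φ 0 0 ω * flux β φ 0 (0 + -1) ω ∂P = ∫ ω, φ 0 (0 + 1) ω * flux β φ 0 0 ω ∂P := by
    have := hφ'F.integral_eq (P := P) hτ 0 (0 + -1)
    simpa using this
  have hbacki : Integrable (fun ω => φ 0 0 ω * flux β φ 0 (0 + -1) ω) P := by
    have := hφ'Fi 0 (0 + -1)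
    simpa using this
  have hβi := hβ.integrable_of_bounded (P := P) hβa 0 0
  have hβG := hβ.mul (hG.mul hG)
  have hβGi := hβG.integrable_of_bounded (P := P) (hmulb hβa (hmulb hGb hGb)) 0 0
  have hFi := hF.integrable_of_bounded (P := P) hFb 0 0
  have hd : Integrable (fun ω => ε * (φ 0 0 ω * φ 0 0 ω) - φ 0 0 ω * flux β φ 0 0 ω) P :=
    ((hφ2i 0).const_mul ε).sub hφFi
  have hsplit : ∫ ω, φ 0 0 ω * (ε * φ 0 0 ω - flux β φ 0 0 ω + flux β φ 0 (0 + -1) ω) ∂P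
      = ε * ∫ ω, φ 0 0 ω ^ 2 ∂P + ∫ ω, β 0 0 ω * tiltedGradient φ 0 0 ω ^ 2 ∂P
        - ∫ ω, flux β φ 0 0 ω ∂P := by
    have e1 : ∫ ω, φ 0 0 ω * (ε * φ 0 0 ω - flux β φ 0 0 ω + flux β φ 0 (0 + -1) ω) ∂P
        = ∫ ω, (ε * (φ 0 0 ω * φ 0 0 ω) - φ 0 0 ω * flux β φ 0 0 ω) ∂P
          + ∫ ω, φ 0 0 ω * flux β φ 0 (0 + -1) ω ∂P := by
      rw [← MeasureTheory.integral_add hd hbacki]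
      congr 1; funext ω; ring
    rw [e1, hback, ← MeasureTheory.integral_add hd (hφ'Fi 0 0),
      ← MeasureTheory.integral_const_mul, ← MeasureTheory.integral_add, ← MeasureTheory.integral_sub]
    · congr 1; funext ω; simp only [flux, tiltedGradient]; ring
    · refine Integrable.add ?_ ?_
      · simpa [pow_two] using (hφ2i 0).const_mul ε
      · simpa [pow_two] using hβGi
    · exact hFi
    · simpa [pow_two] using (hφ2i 0).const_mul ε
    · simpa [pow_two] using hβGi
  -- Young's inequality 2G ≤ 1 + G², weighted by β; half of the energy is then absorbed on the left.
  have hyoung : ∫ ω, flux β φ 0 0 ω ∂P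
      ≤ (∫ ω, β 0 0 ω ∂P + ∫ ω, β 0 0 ω * tiltedGradient φ 0 0 ω ^ 2 ∂P) / 2 := by
    rw [← MeasureTheory.integral_add hβi (by simpa [pow_two] using hβGi),
      ← MeasureTheory.integral_div]
    apply integral_mono hFi
    · exact (hβi.add (by simpa [pow_two] using hβGi)).div_const 2
    · intro ω
      simp only [flux]
      nlinarith [mul_nonneg (hβ0 0 0 ω) (sq_nonneg (1 - tiltedGradient φ 0 0 ω))]
  linarith

/-- An integrable environment of conductances, invariant under the shifts. -/
structure IsEnvironment (P : Measure Ω) (b : ℝ → ℤ → Ω → ℝ) (τ : ℝ → ℤ → Ω → Ω) : Prop where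
  stationary : IsStationaryField b τ b
  pos : ∀ t x ω, 0 < b t x ω
  invariant : ∀ t x, MeasurePreserving (τ t x) P P
  integrable : Integrable (b 0 0) P
  integrable_inv : Integrable (fun ω => (b 0 0 ω)⁻¹) P

/-- The energy of a pair consisting of a corrector and a flux. -/
noncomputable def pairEnergy (P : Measure Ω) (b : ℝ → ℤ → Ω → ℝ) (φ f : ℝ → ℤ → Ω → ℝ) : ℝ :=
  ∫ ω, (min (b 0 0 ω) 1 * tiltedGradient φ 0 0 ω ^ 2 + (b 0 0 ω)⁻¹ * f 0 0 ω ^ 2) ∂P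

/-- The energy of the difference of two pairs. -/
noncomputable def pairDist (P : Measure Ω) (b : ℝ → ℤ → Ω → ℝ)
    (φ f φ' f' : ℝ → ℤ → Ω → ℝ) : ℝ :=
  ∫ ω, (min (b 0 0 ω) 1 * (tiltedGradient φ' 0 0 ω - tiltedGradient φ 0 0 ω) ^ 2
    + (b 0 0 ω)⁻¹ * (f' 0 0 ω - f 0 0 ω) ^ 2) ∂P

/-- Approximate correctors `φ` with flux `f` and error `e`: the flux is the true one as long as the
conductance is at most `N`. -/
structure IsApproxCorrector (P : Measure Ω) (b : ℝ → ℤ → Ω → ℝ) (τ : ℝ → ℤ → Ω → Ω) (N : ℕ)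
    (φ f e : ℝ → ℤ → Ω → ℝ) : Prop where
  stationary : IsStationaryField b τ φ
  stationary_flux : IsStationaryField b τ f
  stationary_error : IsStationaryField b τ e
  bounded : ∃ M, ∀ t x ω, |φ t x ω| ≤ M
  bounded_flux : ∃ M, ∀ t x ω, |f t x ω| ≤ M
  bounded_error : ∃ M, ∀ t x ω, |e t x ω| ≤ M
  nonneg : ∀ t x ω, 0 ≤ tiltedGradient φ t x ω
  equation : ∀ s t x ω, φ t x ω - φ s x ω = ∫ r in s..t, (e r x ω - f r x ω + f r (x + -1) ω)
  flux_eq : ∀ t x ω, b t x ω ≤ N → f t x ω = b t x ω * tiltedGradient φ t x ω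
  energy_le : pairEnergy P b φ f ≤ 2 * ∫ ω, b 0 0 ω ∂P
  error_le : ∫ ω, |e 0 0 ω| ∂P ≤ (1 + ∫ ω, b 0 0 ω ∂P) / (N + 1)

theorem IsApproxCorrector.mono {P : Measure Ω} {b φ f e : ℝ → ℤ → Ω → ℝ} {τ : ℝ → ℤ → Ω → Ω}
    (hb : ∀ t x ω, 0 < b t x ω) {N N' : ℕ} (hN : N ≤ N') (h : IsApproxCorrector P b τ N' φ f e) :
    IsApproxCorrector P b τ N φ f e where
  __ := h
  flux_eq t x ω hx := h.flux_eq t x ω (hx.trans (by exact_mod_cast hN))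
  error_le := by
    refine h.error_le.trans ?_
    have : 0 ≤ ∫ ω, b 0 0 ω ∂P := integral_nonneg fun ω => (hb 0 0 ω).le
    gcongr

section Environment

variable {P : Measure Ω} {b : ℝ → ℤ → Ω → ℝ} {τ : ℝ → ℤ → Ω → Ω}

theorem IsEnvironment.integrable_inv_mul_sq (env : IsEnvironment P b τ) {g : Ω → ℝ}
    (hg : Measurable g) {M : ℝ} (hM : ∀ ω, |g ω| ≤ M) :
    Integrable (fun ω => (b 0 0 ω)⁻¹ * g ω ^ 2) P := by
  refine env.integrable_inv.mul_bdd (c := M ^ 2) (hg.pow_const 2).aestronglyMeasurable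
    (Eventually.of_forall fun ω => ?_)
  rw [Real.norm_eq_abs, abs_of_nonneg (sq_nonneg _)]
  exact sq_le_sq' (abs_le.1 (hM ω)).1 (abs_le.1 (hM ω)).2

variable [IsProbabilityMeasure P]

theorem IsEnvironment.integrable_min_mul_sq (env : IsEnvironment P b τ) {g : Ω → ℝ}
    (hg : Measurable g) {M : ℝ} (hM : ∀ ω, |g ω| ≤ M) :
    Integrable (fun ω => min (b 0 0 ω) 1 * g ω ^ 2) P := by
  refine Integrable.of_bound (C := M ^ 2) ?_ (Eventually.of_forall fun ω => ?_)
  · exact (((env.stationary.measurable_at 0 0).min measurable_const).mul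
      (hg.pow_const 2)).aestronglyMeasurable
  · have h0 : 0 ≤ min (b 0 0 ω) 1 := le_min (env.pos 0 0 ω).le zero_le_one
    rw [Real.norm_eq_abs, abs_of_nonneg (by positivity)]
    have h1 : g ω ^ 2 ≤ M ^ 2 := sq_le_sq' (abs_le.1 (hM ω)).1 (abs_le.1 (hM ω)).2
    nlinarith [min_le_right (b 0 0 ω) 1, sq_nonneg (g ω)]

/-- Truncate at n = N + 1 and take the mass δ² with δ = 1/n. The error δ²φ is controlled by δ²|φ| ≤
δ + δ·δ²φ², and the energy estimate bounds E δ²φ², so its L¹ norm is of order δ. -/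
theorem IsEnvironment.exists_isApproxCorrector (env : IsEnvironment P b τ) (N : ℕ) :
    ∃ φ f e, IsApproxCorrector P b τ N φ f e := by
  set n : ℝ := N + 1 with hn_def
  have hn : 0 < n := by positivity
  have hn1 : 1 ≤ n := by rw [hn_def]; linarith [N.cast_nonneg (α := ℝ)]
  set δ : ℝ := 1 / n with hδ_def
  have hδ : 0 < δ := by positivity
  set β : ℝ → ℤ → Ω → ℝ := fun t x ω => min (b t x ω) n with hβ_def
  have hβ : IsStationaryField b τ β := env.stationary.map (h := fun y => min y n) (by fun_prop)
  have hβ0 : ∀ t x ω, 0 ≤ β t x ω := fun t x ω => le_min (env.pos t x ω).le hn.le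
  have hβn : ∀ t x ω, β t x ω ≤ n := fun t x ω => min_le_right _ _
  obtain ⟨φ, hφ, ⟨M, hM⟩, hpos, heq⟩ :=
    exists_bounded_corrector hn (pow_pos hδ 2) hβ hβ0 hβn
  have hen := energy_estimate env.invariant hβ hβ0 hβn hφ hM heq
  have hβb : ∫ ω, β 0 0 ω ∂P ≤ ∫ ω, b 0 0 ω ∂P := by
    refine integral_mono_of_nonneg (Eventually.of_forall fun ω => hβ0 0 0 ω) env.integrable
      (Eventually.of_forall fun ω => min_le_left _ _)
  have hφ2 : 0 ≤ ∫ ω, φ 0 0 ω ^ 2 ∂P := integral_nonneg fun ω => sq_nonneg _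
  have hβG0 : 0 ≤ ∫ ω, β 0 0 ω * tiltedGradient φ 0 0 ω ^ 2 ∂P :=
    integral_nonneg fun ω => mul_nonneg (hβ0 _ _ _) (sq_nonneg _)
  have hGm := hφ.tiltedGradient.measurable_at 0 0
  have hGb := abs_tiltedGradient_le hM 0 0
  have hFb : ∀ t x ω, |flux β φ t x ω| ≤ n * (1 + 2 * M) := fun t x ω => by
    rw [flux, abs_mul, abs_of_nonneg (hβ0 t x ω)]
    exact mul_le_mul (hβn t x ω) (abs_tiltedGradient_le hM t x ω) (abs_nonneg _) hn.le
  have hβGi : Integrable (fun ω => β 0 0 ω * tiltedGradient φ 0 0 ω ^ 2) P := by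
    refine Integrable.of_bound (C := n * (1 + 2 * M) ^ 2)
      ((hβ.measurable_at 0 0).mul (hGm.pow_const 2)).aestronglyMeasurable
      (Eventually.of_forall fun ω => ?_)
    rw [norm_mul, Real.norm_eq_abs, Real.norm_eq_abs, abs_of_nonneg (hβ0 _ _ _), abs_pow]
    exact mul_le_mul (hβn _ _ _) (pow_le_pow_left₀ (abs_nonneg _) (hGb ω) 2) (by positivity) hn.le
  have hφ2i : Integrable (fun ω => φ 0 0 ω ^ 2) P := by
    refine Integrable.of_bound (C := M ^ 2)
      ((hφ.measurable_at 0 0).pow_const 2).aestronglyMeasurable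
      (Eventually.of_forall fun ω => ?_)
    rw [Real.norm_eq_abs, abs_pow]
    exact pow_le_pow_left₀ (abs_nonneg _) (hM _ _ ω) 2
  refine ⟨φ, flux β φ, fun t x ω => δ ^ 2 * φ t x ω, hφ, hβ.flux hφ,
    (IsStationaryField.const _).mul hφ, ⟨M, hM⟩, ⟨_, hFb⟩, ⟨δ ^ 2 * M, fun t x ω => ?_⟩, hpos, heq,
    fun t x ω hx => ?_, ?_, ?_⟩
  · rw [abs_mul, abs_of_nonneg (by positivity)]
    exact mul_le_mul_of_nonneg_left (hM _ _ _) (by positivity)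
  · simp only [flux, hβ_def]
    rw [min_eq_left]
    linarith
  · unfold pairEnergy
    have h1 : ∫ ω, (min (b 0 0 ω) 1 * tiltedGradient φ 0 0 ω ^ 2
        + (b 0 0 ω)⁻¹ * flux β φ 0 0 ω ^ 2) ∂P
        ≤ ∫ ω, 2 * (β 0 0 ω * tiltedGradient φ 0 0 ω ^ 2) ∂P := by
      apply integral_mono
      · exact (env.integrable_min_mul_sq hGm hGb).add
          (env.integrable_inv_mul_sq ((hβ.flux hφ).measurable_at 0 0) (hFb 0 0))
      · exact hβGi.const_mul 2
      · intro ω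
        have hb := env.pos 0 0 ω
        -- Both halves of the pair energy are dominated by βG²: the first because n ≥ 1, the second
        -- because β ≤ b gives b⁻¹(βG)² ≤ βG². The weights of the pair energy do not depend on n, so
        -- different truncations can be compared.
        have e1 : min (b 0 0 ω) 1 ≤ β 0 0 ω := min_le_min le_rfl hn1
        have e2 : (b 0 0 ω)⁻¹ * flux β φ 0 0 ω ^ 2 ≤ β 0 0 ω * tiltedGradient φ 0 0 ω ^ 2 := by
          have e3 : (b 0 0 ω)⁻¹ * β 0 0 ω ≤ 1 := by
            rw [inv_mul_le_iff₀ hb, mul_one]; exact min_le_left _ _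
          have e4 : (b 0 0 ω)⁻¹ * flux β φ 0 0 ω ^ 2
              = ((b 0 0 ω)⁻¹ * β 0 0 ω) * (β 0 0 ω * tiltedGradient φ 0 0 ω ^ 2) := by
            simp only [flux]; ring
          rw [e4]
          exact mul_le_of_le_one_left (mul_nonneg (hβ0 _ _ _) (sq_nonneg _)) e3
        have e5 := mul_le_mul_of_nonneg_right e1 (sq_nonneg (tiltedGradient φ 0 0 ω))
        simp only
        linarith
    rw [MeasureTheory.integral_const_mul] at h1
    have : 0 ≤ δ ^ 2 * ∫ ω, φ 0 0 ω ^ 2 ∂P := by positivity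
    linarith
  · have h1 : ∫ ω, |δ ^ 2 * φ 0 0 ω| ∂P ≤ ∫ ω, (δ + δ * (δ ^ 2 * φ 0 0 ω ^ 2)) ∂P := by
      apply integral_mono
      · exact ((hφ.integrable_of_bounded hM 0 0).const_mul _).abs
      · exact (integrable_const _).add ((hφ2i.const_mul _).const_mul _)
      · intro ω
        simp only
        rw [abs_mul, abs_of_nonneg (by positivity : 0 ≤ δ ^ 2), ← sq_abs (φ 0 0 ω)]
        nlinarith [mul_nonneg hδ.le (sq_nonneg (1 - δ * |φ 0 0 ω|)), abs_nonneg (φ 0 0 ω),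
          mul_nonneg hδ.le (mul_nonneg hδ.le (abs_nonneg (φ 0 0 ω)))]
    rw [MeasureTheory.integral_add (integrable_const _) ((hφ2i.const_mul _).const_mul _),
      MeasureTheory.integral_const_mul, MeasureTheory.integral_const_mul] at h1
    simp only [integral_const, probReal_univ, one_smul] at h1
    have h2 : (1 + ∫ ω, b 0 0 ω ∂P) / (N + 1) = δ * (1 + ∫ ω, b 0 0 ω ∂P) := by
      rw [hδ_def, hn_def]; ring
    rw [h2]
    have h3 : 0 ≤ δ ^ 2 * ∫ ω, φ 0 0 ω ^ 2 ∂P := by positivity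
    nlinarith

end Environment

end

/-! ### Near minimizers of the energy and geometric convergence in L¹ -/

section

/-- Near-minimizers of a uniformly convex functional on a decreasing sequence of midpoint convex
sets form a Cauchy sequence with a geometric rate, along suitable indices. -/
theorem exists_geometric_near_minimizers {V : Type*} (K : ℕ → Set V) (hK : Antitone K)
    (hne : ∀ N, (K N).Nonempty) (Q : V → ℝ) (D : V → V → ℝ) (B : ℝ)
    (hQ0 : ∀ v, 0 ≤ Q v) (hQB : ∀ N, ∀ v ∈ K N, Q v ≤ B)
    (hmid : ∀ N, ∀ v ∈ K N, ∀ w ∈ K N, ∃ m ∈ K N, Q m ≤ (Q v + Q w) / 2 - D v w / 4) :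
    ∃ v : ℕ → V, (∀ k, v k ∈ K k) ∧ ∀ k, D (v k) (v (k + 1)) ≤ 6 * (1 / 4) ^ k := by
  set d : ℕ → ℝ := fun N => sInf (Q '' K N) with hd
  have hbdd : ∀ N, BddBelow (Q '' K N) := fun N => ⟨0, by rintro _ ⟨v, _, rfl⟩; exact hQ0 v⟩
  have hdle : ∀ N, ∀ v ∈ K N, d N ≤ Q v := fun N v hv => csInf_le (hbdd N) ⟨v, hv, rfl⟩
  have hdmono : Monotone d := fun N N' h =>
    csInf_le_csInf (hbdd N) ((hne N').image Q) (image_mono (hK h))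
  have hdB : ∀ N, d N ≤ B := fun N => by
    obtain ⟨v, hv⟩ := hne N
    exact (hdle N v hv).trans (hQB N v hv)
  have hdbdd : BddAbove (range d) := ⟨B, by rintro _ ⟨N, rfl⟩; exact hdB N⟩
  have hlim := tendsto_atTop_ciSup hdmono hdbdd
  set L := ⨆ N, d N with hL
  have hdL : ∀ N, d N ≤ L := fun N => le_ciSup hdbdd N
  have hM : ∀ k : ℕ, ∃ M, ∀ N, M ≤ N → L - (1 / 4 : ℝ) ^ k < d N := fun k => by
    have := hlim.eventually (lt_mem_nhds (show L - (1 / 4 : ℝ) ^ k < L by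
      have : (0 : ℝ) < (1 / 4) ^ k := by positivity
      linarith))
    exact eventually_atTop.1 this
  choose M hM using hM
  -- Summing the thresholds makes N monotone, so that two consecutive near minimizers lie in the
  -- common set K (N k).
  set N : ℕ → ℕ := fun k => k + ∑ i ∈ Finset.range (k + 1), M i with hN
  have hNM : ∀ k, M k ≤ N k := fun k =>
    (Finset.single_le_sum (f := M) (fun _ _ => Nat.zero_le _)
      (Finset.self_mem_range_succ k)).trans (Nat.le_add_left _ _)
  have hNk : ∀ k, k ≤ N k := fun k => Nat.le_add_right _ _
  have hNs : ∀ k, N k ≤ N (k + 1) := fun k => by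
    simp only [hN]
    rw [Finset.sum_range_succ _ (k + 1)]
    omega
  have hv : ∀ k, ∃ v ∈ K (N k), Q v < d (N k) + (1 / 4) ^ k := fun k => by
    obtain ⟨_, ⟨v, hv, rfl⟩, h⟩ := Real.lt_sInf_add_pos ((hne (N k)).image Q)
      (show (0 : ℝ) < (1 / 4) ^ k by positivity)
    exact ⟨v, hv, h⟩
  choose v hvK hvQ using hv
  refine ⟨v, fun k => hK (hNk k) (hvK k), fun k => ?_⟩
  obtain ⟨m, hm, hmQ⟩ := hmid (N k) (v k) (hvK k) (v (k + 1)) (hK (hNs k) (hvK (k + 1)))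
  have h1 := hdle (N k) m hm
  have h2 := hM k (N k) (hNM k)
  have h3 := hvQ k
  have h4 := hvQ (k + 1)
  have h5 := hdL (N (k + 1))
  have h6 : (1 / 4 : ℝ) ^ (k + 1) ≤ (1 / 4) ^ k := by
    rw [pow_succ]
    have : (0 : ℝ) < (1 / 4) ^ k := by positivity
    linarith
  -- With q = 4^{-k}: the midpoint has energy at least d(N k) > L − q, and the two energies are
  -- below d(N k) + q and L + q. Hence D/4 < q/2 + q, which is the constant 6.
  linarith

section Environment

variable {Ω : Type*} [MeasurableSpace Ω] {P : Measure Ω}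
  {b : ℝ → ℤ → Ω → ℝ} {τ : ℝ → ℤ → Ω → Ω}

theorem IsApproxCorrector.intervalIntegrable {N : ℕ} {φ f e : ℝ → ℤ → Ω → ℝ}
    (h : IsApproxCorrector P b τ N φ f e) (x : ℤ) (ω : Ω) (s t : ℝ) :
    IntervalIntegrable (fun r => f r x ω) volume s t ∧
      IntervalIntegrable (fun r => e r x ω) volume s t := by
  obtain ⟨A, hA⟩ := h.bounded_flux
  obtain ⟨M, hM⟩ := h.bounded_error
  exact ⟨intervalIntegrable_of_bounded (h.stationary_flux.measurable_path x ω)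
      (fun r => hA r x ω) s t,
    intervalIntegrable_of_bounded (h.stationary_error.measurable_path x ω)
      (fun r => hM r x ω) s t⟩

/-- This replaces Cauchy–Schwarz by 2|u| ≤ c⁻¹wu² + cw⁻¹. When the weighted energy is of order c²,
both terms are linear in c. -/
theorem integral_abs_le_of_weighted_sq {w u : Ω → ℝ} (hw : ∀ ω, 0 < w ω) {A E c : ℝ} (hc : 0 < c)
    (hu : Integrable u P) (hwi : Integrable (fun ω => (w ω)⁻¹) P) (hA : ∫ ω, (w ω)⁻¹ ∂P ≤ A)
    (hi : Integrable (fun ω => w ω * u ω ^ 2) P) (hE : ∫ ω, w ω * u ω ^ 2 ∂P ≤ E * c ^ 2) :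
    ∫ ω, |u ω| ∂P ≤ (A + E) * c := by
  have h1 : ∫ ω, |u ω| ∂P ≤ ∫ ω, (c⁻¹ * (w ω * u ω ^ 2) + c * (w ω)⁻¹) ∂P := by
    apply integral_mono hu.abs ((hi.const_mul _).add (hwi.const_mul _))
    intro ω
    have hw' := hw ω
    have h0 : 0 ≤ c⁻¹ * w ω * (|u ω| - c * (w ω)⁻¹) ^ 2 := by positivity
    have e : c⁻¹ * w ω * (|u ω| - c * (w ω)⁻¹) ^ 2
        = c⁻¹ * (w ω * u ω ^ 2) + c * (w ω)⁻¹ - 2 * |u ω| := by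
      rw [← sq_abs (u ω)]
      field_simp
      ring
    simp only [Pi.add_apply]
    linarith [abs_nonneg (u ω)]
  rw [MeasureTheory.integral_add (hi.const_mul _) (hwi.const_mul _),
    MeasureTheory.integral_const_mul, MeasureTheory.integral_const_mul] at h1
  have h2 : c⁻¹ * ∫ ω, w ω * u ω ^ 2 ∂P ≤ E * c := by
    rw [inv_mul_le_iff₀ hc]
    linarith
  have h3 := mul_le_mul_of_nonneg_left hA hc.le
  linarith

variable [IsProbabilityMeasure P]

theorem IsApproxCorrector.integrable_energy (env : IsEnvironment P b τ) {N : ℕ}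
    {φ f e : ℝ → ℤ → Ω → ℝ} (h : IsApproxCorrector P b τ N φ f e) :
    Integrable (fun ω => min (b 0 0 ω) 1 * tiltedGradient φ 0 0 ω ^ 2
      + (b 0 0 ω)⁻¹ * f 0 0 ω ^ 2) P := by
  obtain ⟨M, hM⟩ := h.bounded
  obtain ⟨A, hA⟩ := h.bounded_flux
  exact (env.integrable_min_mul_sq (h.stationary.tiltedGradient.measurable_at 0 0)
    (abs_tiltedGradient_le hM 0 0)).add
    (env.integrable_inv_mul_sq (h.stationary_flux.measurable_at 0 0) (hA 0 0))

theorem IsApproxCorrector.integrable_dist (env : IsEnvironment P b τ) {N N' : ℕ}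
    {φ f e φ' f' e' : ℝ → ℤ → Ω → ℝ} (h : IsApproxCorrector P b τ N φ f e)
    (h' : IsApproxCorrector P b τ N' φ' f' e') :
    Integrable (fun ω => min (b 0 0 ω) 1 * (tiltedGradient φ' 0 0 ω - tiltedGradient φ 0 0 ω) ^ 2
      + (b 0 0 ω)⁻¹ * (f' 0 0 ω - f 0 0 ω) ^ 2) P := by
  obtain ⟨M, hM⟩ := h.bounded
  obtain ⟨A, hA⟩ := h.bounded_flux
  obtain ⟨M', hM'⟩ := h'.bounded
  obtain ⟨A', hA'⟩ := h'.bounded_flux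
  exact (env.integrable_min_mul_sq ((h'.stationary.tiltedGradient.measurable_at 0 0).sub
    (h.stationary.tiltedGradient.measurable_at 0 0)) (fun ω => (abs_sub _ _).trans
      (add_le_add (abs_tiltedGradient_le hM' 0 0 ω) (abs_tiltedGradient_le hM 0 0 ω)))).add
    (env.integrable_inv_mul_sq ((h'.stationary_flux.measurable_at 0 0).sub
      (h.stationary_flux.measurable_at 0 0)) (fun ω => (abs_sub _ _).trans
      (add_le_add (hA' 0 0 ω) (hA 0 0 ω))))

/-- Midpoints of approximate correctors are approximate correctors, and the energy satisfies the
parallelogram identity. -/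
theorem IsApproxCorrector.midpoint (env : IsEnvironment P b τ) {N : ℕ}
    {φ f e φ' f' e' : ℝ → ℤ → Ω → ℝ} (h : IsApproxCorrector P b τ N φ f e)
    (h' : IsApproxCorrector P b τ N φ' f' e') :
    ∃ φ'' f'' e'', IsApproxCorrector P b τ N φ'' f'' e'' ∧
      pairEnergy P b φ'' f'' ≤ (pairEnergy P b φ f + pairEnergy P b φ' f') / 2
        - pairDist P b φ f φ' f' / 4 := by
  have hgrad : ∀ t x ω,
      tiltedGradient (fun t x ω => 1 / 2 * (φ t x ω + φ' t x ω)) t x ω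
        = 1 / 2 * (tiltedGradient φ t x ω + tiltedGradient φ' t x ω) := fun t x ω => by
    simp only [tiltedGradient]; ring
  have hE : pairEnergy P b (fun t x ω => 1 / 2 * (φ t x ω + φ' t x ω))
      (fun t x ω => 1 / 2 * (f t x ω + f' t x ω))
      = (pairEnergy P b φ f + pairEnergy P b φ' f') / 2 - pairDist P b φ f φ' f' / 4 := by
    have i1 := h.integrable_energy env
    have i2 := h'.integrable_energy env
    have i3 := h.integrable_dist env h'
    unfold pairEnergy pairDist
    have i12 := (i1.add i2).div_const 2
    simp only [Pi.add_apply] at i12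
    rw [← MeasureTheory.integral_add i1 i2, ← MeasureTheory.integral_div,
      ← MeasureTheory.integral_div, ← MeasureTheory.integral_sub i12 (i3.div_const 4)]
    congr 1; funext ω
    rw [hgrad]
    ring
  have hD0 : 0 ≤ pairDist P b φ f φ' f' := by
    refine integral_nonneg fun ω => ?_
    have := (env.pos 0 0 ω)
    have h2 : 0 ≤ min (b 0 0 ω) 1 := le_min this.le zero_le_one
    simp only [Pi.zero_apply]
    positivity
  have hbd : ∀ {u u' : ℝ → ℤ → Ω → ℝ}, (∃ M, ∀ t x ω, |u t x ω| ≤ M) →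
      (∃ M, ∀ t x ω, |u' t x ω| ≤ M) →
      ∃ M, ∀ t x ω, |1 / 2 * (u t x ω + u' t x ω)| ≤ M := by
    rintro u u' ⟨M, hM⟩ ⟨M', hM'⟩
    refine ⟨1 / 2 * (M + M'), fun t x ω => ?_⟩
    rw [abs_mul, abs_of_pos (by norm_num : (0 : ℝ) < 1 / 2)]
    exact mul_le_mul_of_nonneg_left ((abs_add_le _ _).trans (add_le_add (hM _ _ _) (hM' _ _ _)))
      (by norm_num)
  have hst : ∀ {u u' : ℝ → ℤ → Ω → ℝ}, IsStationaryField b τ u → IsStationaryField b τ u' →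
      IsStationaryField b τ (fun t x ω => 1 / 2 * (u t x ω + u' t x ω)) := fun hu hu' =>
    (IsStationaryField.const _).mul (hu.add hu')
  refine ⟨_, _, fun t x ω => 1 / 2 * (e t x ω + e' t x ω),
    ⟨hst h.stationary h'.stationary, hst h.stationary_flux h'.stationary_flux,
    hst h.stationary_error h'.stationary_error, hbd h.bounded h'.bounded,
    hbd h.bounded_flux h'.bounded_flux, hbd h.bounded_error h'.bounded_error, ?_, ?_, ?_, ?_, ?_⟩,
    hE.le⟩
  · intro t x ω
    rw [hgrad]
    linarith [h.nonneg t x ω, h'.nonneg t x ω]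
  · intro s t x ω
    have e1 := h.equation s t x ω
    have e2 := h'.equation s t x ω
    have i1 := h.intervalIntegrable x ω s t
    have i2 := h'.intervalIntegrable x ω s t
    have i3 := h.intervalIntegrable (x + -1) ω s t
    have i4 := h'.intervalIntegrable (x + -1) ω s t
    have : 1 / 2 * (φ t x ω + φ' t x ω) - 1 / 2 * (φ s x ω + φ' s x ω)
        = 1 / 2 * ((φ t x ω - φ s x ω) + (φ' t x ω - φ' s x ω)) := by ring
    rw [this, e1, e2, ← intervalIntegral.integral_add ((i1.2.sub i1.1).add i3.1)
      ((i2.2.sub i2.1).add i4.1), ← intervalIntegral.integral_const_mul]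
    congr 1; funext r; ring
  · intro t x ω hx
    rw [hgrad, h.flux_eq t x ω hx, h'.flux_eq t x ω hx]
    ring
  · rw [hE]
    linarith [h.energy_le, h'.energy_le]
  · obtain ⟨M, hM⟩ := h.bounded_error
    obtain ⟨M', hM'⟩ := h'.bounded_error
    have i1 := (h.stationary_error.integrable_of_bounded (P := P) hM 0 0).abs
    have i2 := (h'.stationary_error.integrable_of_bounded (P := P) hM' 0 0).abs
    have : ∫ ω, |1 / 2 * (e 0 0 ω + e' 0 0 ω)| ∂P
        ≤ ∫ ω, 1 / 2 * (|e 0 0 ω| + |e' 0 0 ω|) ∂P := by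
      refine integral_mono_of_nonneg (Eventually.of_forall fun ω => abs_nonneg _)
        ((i1.add i2).const_mul _) (Eventually.of_forall fun ω => ?_)
      simp only
      rw [abs_mul, abs_of_pos (by norm_num : (0 : ℝ) < 1 / 2)]
      exact mul_le_mul_of_nonneg_left (abs_add_le _ _) (by norm_num)
    rw [MeasureTheory.integral_const_mul, MeasureTheory.integral_add i1 i2] at this
    linarith [h.error_le, h'.error_le]

/-- A sequence of approximate correctors converging geometrically in `L¹`. -/
theorem IsEnvironment.exists_approximation (env : IsEnvironment P b τ) :
    ∃ (C : ℝ) (φ f e : ℕ → ℝ → ℤ → Ω → ℝ),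
      (∀ k, IsApproxCorrector P b τ k (φ k) (f k) (e k)) ∧
      (∀ k, ∫ ω, |tiltedGradient (φ (k + 1)) 0 0 ω - tiltedGradient (φ k) 0 0 ω| ∂P
        ≤ C * (1 / 2) ^ k) ∧
      (∀ k, ∫ ω, |f (k + 1) 0 0 ω - f k 0 0 ω| ∂P ≤ C * (1 / 2) ^ k) ∧
      ∀ k, ∫ ω, |e k 0 0 ω| ∂P ≤ C * (1 / 2) ^ k := by
  set B := ∫ ω, b 0 0 ω ∂P with hB
  have hB0 : 0 ≤ B := integral_nonneg fun ω => (env.pos 0 0 ω).le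
  set A := ∫ ω, (b 0 0 ω)⁻¹ ∂P with hA
  have hA0 : 0 ≤ A := integral_nonneg fun ω => (inv_pos.2 (env.pos 0 0 ω)).le
  have hE0 : ∀ v : (ℝ → ℤ → Ω → ℝ) × (ℝ → ℤ → Ω → ℝ) × (ℝ → ℤ → Ω → ℝ),
      0 ≤ pairEnergy P b v.1 v.2.1 := fun v => by
    refine integral_nonneg fun ω => ?_
    have := (env.pos 0 0 ω)
    have h2 : 0 ≤ min (b 0 0 ω) 1 := le_min this.le zero_le_one
    simp only [Pi.zero_apply]
    positivity
  obtain ⟨v, hv, hD⟩ := exists_geometric_near_minimizers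
    (V := (ℝ → ℤ → Ω → ℝ) × (ℝ → ℤ → Ω → ℝ) × (ℝ → ℤ → Ω → ℝ))
    -- The index 2^N turns the error bound of order 1/(N + 1) into a geometric rate.
    (fun N => {v | IsApproxCorrector P b τ (2 ^ N) v.1 v.2.1 v.2.2})
    (fun N N' h v hv => IsApproxCorrector.mono env.pos (Nat.pow_le_pow_right (by norm_num) h) hv)
    (fun N => by
      obtain ⟨φ, f, e, h⟩ := env.exists_isApproxCorrector (2 ^ N)
      exact ⟨(φ, f, e), h⟩)
    (fun v => pairEnergy P b v.1 v.2.1) (fun v w => pairDist P b v.1 v.2.1 w.1 w.2.1) (2 * B)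
    hE0 (fun N v hv => hv.energy_le)
    (fun N v hv w hw => by
      obtain ⟨φ, f, e, h, hE⟩ := IsApproxCorrector.midpoint env hv hw
      exact ⟨(φ, f, e), h, hE⟩)
  have hquart : ∀ k : ℕ, (1 / 4 : ℝ) ^ k = ((1 / 2) ^ k) ^ 2 := fun k => by
    rw [← pow_mul, mul_comm, pow_mul]; norm_num
  -- The energy distance decays like 4^{-k}, hence L¹ distances like 2^{-k}. Gradients carry the
  -- weight min(b,1), whose inverse is at most 1 + b⁻¹; fluxes carry b⁻¹, whose inverse is b. Both
  -- moment assumptions enter here.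
  have hpart : ∀ k,
      (∫ ω, |tiltedGradient (v (k + 1)).1 0 0 ω - tiltedGradient (v k).1 0 0 ω| ∂P
        ≤ (1 + A + 6) * (1 / 2) ^ k) ∧
      ∫ ω, |(v (k + 1)).2.1 0 0 ω - (v k).2.1 0 0 ω| ∂P ≤ (B + 6) * (1 / 2) ^ k := by
    intro k
    have h : IsApproxCorrector P b τ (2 ^ k) (v k).1 (v k).2.1 (v k).2.2 := hv k
    have h' : IsApproxCorrector P b τ (2 ^ (k + 1)) (v (k + 1)).1 (v (k + 1)).2.1 (v (k + 1)).2.2 :=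
      hv (k + 1)
    have hDk := hD k
    simp only [pairDist] at hDk
    obtain ⟨M, hM⟩ := h.bounded
    obtain ⟨F, hF⟩ := h.bounded_flux
    obtain ⟨M', hM'⟩ := h'.bounded
    obtain ⟨F', hF'⟩ := h'.bounded_flux
    have i1 : Integrable (fun ω => min (b 0 0 ω) 1 *
        (tiltedGradient (v (k + 1)).1 0 0 ω - tiltedGradient (v k).1 0 0 ω) ^ 2) P :=
      env.integrable_min_mul_sq ((h'.stationary.tiltedGradient.measurable_at 0 0).sub
      (h.stationary.tiltedGradient.measurable_at 0 0)) (fun ω => (abs_sub _ _).trans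
      (add_le_add (abs_tiltedGradient_le hM' 0 0 ω) (abs_tiltedGradient_le hM 0 0 ω)))
    have i2 : Integrable (fun ω => (b 0 0 ω)⁻¹ *
        ((v (k + 1)).2.1 0 0 ω - (v k).2.1 0 0 ω) ^ 2) P :=
      env.integrable_inv_mul_sq ((h'.stationary_flux.measurable_at 0 0).sub
      (h.stationary_flux.measurable_at 0 0)) (fun ω => (abs_sub _ _).trans
      (add_le_add (hF' 0 0 ω) (hF 0 0 ω)))
    have hw : ∀ ω, 0 < min (b 0 0 ω) 1 := fun ω => lt_min (env.pos 0 0 ω) one_pos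
    have hw' : ∀ ω, 0 < (b 0 0 ω)⁻¹ := fun ω => inv_pos.2 (env.pos 0 0 ω)
    rw [MeasureTheory.integral_add i1 i2, hquart] at hDk
    have n1 : 0 ≤ ∫ ω, min (b 0 0 ω) 1 *
        (tiltedGradient (v (k + 1)).1 0 0 ω - tiltedGradient (v k).1 0 0 ω) ^ 2 ∂P :=
      integral_nonneg fun ω => mul_nonneg (hw ω).le (sq_nonneg _)
    have n2 : 0 ≤ ∫ ω, (b 0 0 ω)⁻¹ * ((v (k + 1)).2.1 0 0 ω - (v k).2.1 0 0 ω) ^ 2 ∂P :=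
      integral_nonneg fun ω => mul_nonneg (hw' ω).le (sq_nonneg _)
    have hinv : ∀ ω, (min (b 0 0 ω) 1)⁻¹ ≤ 1 + (b 0 0 ω)⁻¹ := fun ω => by
      rcases min_choice (b 0 0 ω) 1 with hh | hh <;> rw [hh]
      · linarith
      · rw [inv_one]; linarith [hw' ω]
    have hmi : Integrable (fun ω => (min (b 0 0 ω) 1)⁻¹) P := by
      refine ((integrable_const 1).add env.integrable_inv).mono'
        ((env.stationary.measurable_at 0 0).min measurable_const).inv.aestronglyMeasurable
        (Eventually.of_forall fun ω => ?_)
      rw [Real.norm_eq_abs, abs_of_pos (inv_pos.2 (hw ω))]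
      exact hinv ω
    constructor
    · refine integral_abs_le_of_weighted_sq hw (by positivity) ?_ hmi ?_ i1 (by linarith)
      · exact (h'.stationary.tiltedGradient.integrable_of_bounded
          (abs_tiltedGradient_le hM') 0 0).sub (h.stationary.tiltedGradient.integrable_of_bounded
          (abs_tiltedGradient_le hM) 0 0)
      · calc _ ≤ ∫ ω, (1 + (b 0 0 ω)⁻¹) ∂P :=
              integral_mono hmi ((integrable_const 1).add env.integrable_inv) hinv
          _ = 1 + A := by
              rw [MeasureTheory.integral_add (integrable_const 1) env.integrable_inv]
              simp [hA]
    · refine integral_abs_le_of_weighted_sq hw' (by positivity) ?_ ?_ ?_ i2 (by linarith)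
      · exact (h'.stationary_flux.integrable_of_bounded hF' 0 0).sub
          (h.stationary_flux.integrable_of_bounded hF 0 0)
      · simpa using env.integrable
      · simp [hB]
  refine ⟨7 + A + B, fun k => (v k).1, fun k => (v k).2.1, fun k => (v k).2.2,
    fun k => IsApproxCorrector.mono env.pos k.lt_two_pow_self.le (hv k), fun k => ?_, fun k => ?_,
    fun k => ?_⟩
  · refine (hpart k).1.trans ?_
    exact mul_le_mul_of_nonneg_right (by linarith) (by positivity)
  · refine (hpart k).2.trans ?_
    exact mul_le_mul_of_nonneg_right (by linarith) (by positivity)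
  · have h : IsApproxCorrector P b τ (2 ^ k) (v k).1 (v k).2.1 (v k).2.2 := hv k
    refine h.error_le.trans ?_
    rw [div_le_iff₀ (by positivity)]
    push_cast
    have e : (1 / 2 : ℝ) ^ k * 2 ^ k = 1 := by rw [← mul_pow]; norm_num
    have : 0 < (1 / 2 : ℝ) ^ k := by positivity
    nlinarith

end Environment

end

/-! ### Geometric L¹ convergence, limits along a sample, propagation of zeros -/

section

section GeometricL1

variable {X : Type*} [MeasurableSpace X] {μ : Measure X}

/-- By Tonelli the sum of the |u k| is integrable. It serves both as a dominating function and,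
through summability, as a proof that u k → 0 almost everywhere. -/
theorem exists_integrable_tsum_of_geometric {u : ℕ → X → ℝ} (hi : ∀ k, Integrable (u k) μ) {C : ℝ}
    (h : ∀ k, ∫ p, |u k p| ∂μ ≤ C * (1 / 2) ^ k) :
    ∃ G : X → ℝ, Integrable G μ ∧ ∀ᵐ p ∂μ, Summable (fun k => |u k p|) ∧
      ∑' k, |u k p| = G p := by
  have hsum : Summable fun k => ∫ p, |u k p| ∂μ := by
    refine Summable.of_nonneg_of_le (fun k => integral_nonneg fun p => abs_nonneg _) h ?_
    exact (summable_geometric_of_lt_one (by norm_num) (by norm_num)).mul_left C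
  have hmeas : ∀ k, AEMeasurable (fun p => ‖u k p‖ₑ) μ := fun k => (hi k).1.enorm
  have hfin : ∫⁻ p, ∑' k, ‖u k p‖ₑ ∂μ ≠ ⊤ := by
    rw [lintegral_tsum hmeas]
    have : ∀ k, ∫⁻ p, ‖u k p‖ₑ ∂μ = ENNReal.ofReal (∫ p, |u k p| ∂μ) := fun k =>
      (ofReal_integral_norm_eq_lintegral_enorm (hi k)).symm
    simp_rw [this]
    exact hsum.tsum_ofReal_ne_top
  have hm : AEMeasurable (fun p => ∑' k, ‖u k p‖ₑ) μ := AEMeasurable.tsum hmeas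
  refine ⟨fun p => (∑' k, ‖u k p‖ₑ).toReal, integrable_toReal_of_lintegral_ne_top hm hfin, ?_⟩
  filter_upwards [ae_lt_top' hm hfin] with p hp
  refine ⟨tsum_enorm_ne_top_iff_summable_norm.1 hp.ne, ?_⟩
  rw [ENNReal.tsum_toReal_eq (fun k => enorm_ne_top)]
  simp

theorem exists_integrable_bound_of_geometric_cauchy {u : ℕ → X → ℝ}
    (hi : ∀ k, Integrable (u k) μ) {C : ℝ}
    (h : ∀ k, ∫ p, |u (k + 1) p - u k p| ∂μ ≤ C * (1 / 2) ^ k) :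
    ∃ G : X → ℝ, Integrable G μ ∧ ∀ᵐ p ∂μ, (∃ y, Tendsto (fun k => u k p) atTop (𝓝 y)) ∧
      ∀ k, |u k p| ≤ G p := by
  obtain ⟨G, hG, hae⟩ := exists_integrable_tsum_of_geometric
    (u := fun k p => u (k + 1) p - u k p) (fun k => (hi (k + 1)).sub (hi k)) h
  refine ⟨fun p => |u 0 p| + G p, (hi 0).abs.add hG, ?_⟩
  filter_upwards [hae] with p hp
  have hrep : ∀ n, u n p = u 0 p + ∑ k ∈ Finset.range n, (u (k + 1) p - u k p) := fun n => by
    rw [Finset.sum_range_sub (fun k => u k p)]; ring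
  refine ⟨⟨u 0 p + ∑' k, (u (k + 1) p - u k p), ?_⟩, fun n => ?_⟩
  · rw [show (fun k => u k p) = fun n => u 0 p + ∑ k ∈ Finset.range n, (u (k + 1) p - u k p) from
      funext hrep]
    exact (hp.1.of_abs.hasSum.tendsto_sum_nat).const_add _
  · rw [hrep n, ← hp.2]
    refine (abs_add_le _ _).trans (add_le_add le_rfl ((Finset.abs_sum_le_sum_abs _ _).trans ?_))
    exact hp.1.sum_le_tsum _ (fun k _ => abs_nonneg _)

/-- Sequences of integrable functions that are Cauchy in `L¹` with a geometric rate. -/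
def IsGeometricCauchy (μ : Measure X) (u : ℕ → X → ℝ) : Prop :=
  (∀ k, Integrable (u k) μ) ∧ ∃ C : ℝ, ∀ k, ∫ p, |u (k + 1) p - u k p| ∂μ ≤ C * (1 / 2) ^ k

theorem IsGeometricCauchy.add {u v : ℕ → X → ℝ} (hu : IsGeometricCauchy μ u)
    (hv : IsGeometricCauchy μ v) : IsGeometricCauchy μ fun k p => u k p + v k p := by
  obtain ⟨hui, C, hC⟩ := hu
  obtain ⟨hvi, D, hD⟩ := hv
  refine ⟨fun k => (hui k).add (hvi k), C + D, fun k => ?_⟩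
  have i1 := ((hui (k + 1)).sub (hui k)).abs
  have i2 := ((hvi (k + 1)).sub (hvi k)).abs
  calc _ ≤ ∫ p, (|u (k + 1) p - u k p| + |v (k + 1) p - v k p|) ∂μ := by
        refine integral_mono_of_nonneg (Eventually.of_forall fun p => abs_nonneg _) (i1.add i2)
          (Eventually.of_forall fun p => ?_)
        simp only
        rw [add_sub_add_comm]
        exact abs_add_le _ _
    _ = ∫ p, |u (k + 1) p - u k p| ∂μ + ∫ p, |v (k + 1) p - v k p| ∂μ :=
        MeasureTheory.integral_add i1 i2
    _ ≤ _ := by linarith [hC k, hD k]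

theorem IsGeometricCauchy.neg {u : ℕ → X → ℝ} (hu : IsGeometricCauchy μ u) :
    IsGeometricCauchy μ fun k p => -u k p := by
  refine ⟨fun k => (hu.1 k).neg, hu.2.imp fun C hC k => ?_⟩
  refine (le_of_eq ?_).trans (hC k)
  congr 1; funext p
  rw [← abs_neg]; congr 1; ring

theorem IsGeometricCauchy.sub {u v : ℕ → X → ℝ} (hu : IsGeometricCauchy μ u)
    (hv : IsGeometricCauchy μ v) : IsGeometricCauchy μ fun k p => u k p - v k p := by
  simpa only [sub_eq_add_neg] using hu.add hv.neg

theorem isGeometricCauchy_of_le {u : ℕ → X → ℝ} (hi : ∀ k, Integrable (u k) μ) {C : ℝ}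
    (hC0 : 0 ≤ C) (h : ∀ k, ∫ p, |u k p| ∂μ ≤ C * (1 / 2) ^ k) : IsGeometricCauchy μ u := by
  refine ⟨hi, 2 * C, fun k => ?_⟩
  have i1 := (hi (k + 1)).abs
  have i2 := (hi k).abs
  calc _ ≤ ∫ p, (|u (k + 1) p| + |u k p|) ∂μ :=
        integral_mono_of_nonneg (Eventually.of_forall fun p => abs_nonneg _) (i1.add i2)
          (Eventually.of_forall fun p => abs_sub _ _)
    _ = ∫ p, |u (k + 1) p| ∂μ + ∫ p, |u k p| ∂μ := MeasureTheory.integral_add i1 i2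
    _ ≤ _ := by
        have h1 := h (k + 1)
        have h2 := h k
        rw [pow_succ] at h1
        have : 0 ≤ C * (1 / 2 : ℝ) ^ k := by positivity
        linarith

end GeometricL1

/-- Passage to the limit in the integrated parabolic equation along a single sample. -/
theorem exists_limit_of_dominated {b : ℝ → ℤ → ℝ} {ψ f e : ℕ → ℝ → ℤ → ℝ}
    (heq : ∀ k s t x, ψ k t x - ψ k s x = ∫ r in s..t, (e k r x - f k r x + f k r (x + -1)))
    (hfm : ∀ k x, Measurable fun r => f k r x) (hem : ∀ k x, Measurable fun r => e k r x)
    (hdom : ∀ (x : ℤ) (T : ℕ), ∃ G : ℝ → ℝ, IntegrableOn G (Ioc (-T : ℝ) T) ∧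
      ∀ᵐ r ∂volume.restrict (Ioc (-T : ℝ) T), (∃ y, Tendsto (fun k => f k r x) atTop (𝓝 y)) ∧
        Tendsto (fun k => e k r x) atTop (𝓝 0) ∧ ∀ k, |f k r x| ≤ G r ∧ |e k r x| ≤ G r)
    (hflux : ∀ r x, ∀ᶠ k in atTop, f k r x = b r x * (ψ k r (x + 1) - ψ k r x))
    (h0 : ∀ x, ∃ y, Tendsto (fun k => ψ k 0 x) atTop (𝓝 y)) :
    ∃ Ψ : ℝ → ℤ → ℝ, (∀ t x, Tendsto (fun k => ψ k t x) atTop (𝓝 (Ψ t x))) ∧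
      (∀ x s t, IntervalIntegrable (fun r => b r x * (Ψ r (x + 1) - Ψ r x)) volume s t) ∧
      ∀ x s t, Ψ t x - Ψ s x = ∫ r in s..t,
        (-(b r x * (Ψ r (x + 1) - Ψ r x)) + b r (x + -1) * (Ψ r x - Ψ r (x + -1))) := by
  set F : ℝ → ℤ → ℝ := fun r x => limUnder atTop (fun k => f k r x) with hF
  have hT : ∀ s t : ℝ, ∃ T : ℕ, uIoc s t ⊆ Ioc (-T : ℝ) T := fun s t => by
    obtain ⟨T, hT⟩ := exists_nat_ge (max |s| |t|)
    refine ⟨T, fun r hr => ?_⟩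
    have h1 := abs_le.1 ((le_max_left _ _).trans hT)
    have h2 := abs_le.1 ((le_max_right _ _).trans hT)
    rcases le_total s t with h | h
    · rw [uIoc_of_le h] at hr
      exact ⟨by linarith [hr.1], by linarith [hr.2]⟩
    · rw [uIoc_of_ge h] at hr
      exact ⟨by linarith [hr.1], by linarith [hr.2]⟩
  have hdom' : ∀ x s t, ∃ G : ℝ → ℝ, IntervalIntegrable G volume s t ∧
      ∀ᵐ r, r ∈ uIoc s t → Tendsto (fun k => f k r x) atTop (𝓝 (F r x)) ∧
        Tendsto (fun k => e k r x) atTop (𝓝 0) ∧ ∀ k, |f k r x| ≤ G r ∧ |e k r x| ≤ G r := by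
    intro x s t
    obtain ⟨T, hTs⟩ := hT s t
    obtain ⟨G, hG, hae⟩ := hdom x T
    refine ⟨G, intervalIntegrable_iff.2 (hG.mono_set hTs), ?_⟩
    rw [ae_restrict_iff' measurableSet_Ioc] at hae
    filter_upwards [hae] with r hr hrm
    obtain ⟨h1, h2, h3⟩ := hr (hTs hrm)
    exact ⟨tendsto_nhds_limUnder h1, h2, h3⟩
  have hFint : ∀ x s t, IntervalIntegrable (fun r => F r x) volume s t := by
    intro x s t
    obtain ⟨G, hG, hae⟩ := hdom' x s t
    rw [intervalIntegrable_iff] at hG ⊢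
    have hae' := (ae_restrict_iff' (measurableSet_uIoc (a := s) (b := t))).2 hae
    refine Integrable.mono' hG ?_ ?_
    · refine aestronglyMeasurable_of_tendsto_ae atTop
        (fun k => (hfm k x).aestronglyMeasurable) ?_
      filter_upwards [hae'] with r hr using hr.1
    · filter_upwards [hae'] with r hr
      exact le_of_tendsto' hr.1.abs fun k => (hr.2.2 k).1
  have hlim : ∀ x s t, Tendsto (fun k => ψ k t x - ψ k s x) atTop
      (𝓝 (∫ r in s..t, (-F r x + F r (x + -1)))) := by
    intro x s t
    simp_rw [heq]
    obtain ⟨G, hG, hae⟩ := hdom' x s t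
    obtain ⟨G', hG', hae'⟩ := hdom' (x + -1) s t
    refine intervalIntegral.tendsto_integral_filter_of_dominated_convergence
      (fun r => G r + G r + G' r) (Eventually.of_forall fun k => ?_)
      (Eventually.of_forall fun k => ?_) ((hG.add hG).add hG') ?_
    · exact (((hem k x).sub (hfm k x)).add (hfm k (x + -1))).aestronglyMeasurable
    · filter_upwards [hae, hae'] with r hr hr' hm
      exact (abs_add_le _ _).trans (add_le_add ((abs_sub _ _).trans
        (add_le_add ((hr hm).2.2 k).2 ((hr hm).2.2 k).1)) ((hr' hm).2.2 k).1)
    · filter_upwards [hae, hae'] with r hr hr' hm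
      have := ((hr hm).2.1.sub (hr hm).1).add (hr' hm).1
      simpa using this
  -- Time increments converge for every s and t, so convergence at time 0 spreads to all times
  -- without a time-dependent null set.
  have hconv : ∀ t x, ∃ y, Tendsto (fun k => ψ k t x) atTop (𝓝 y) := by
    intro t x
    obtain ⟨y, hy⟩ := h0 x
    refine ⟨_, ((hlim x 0 t).add hy).congr fun k => ?_⟩
    ring
  choose Ψ hΨ using hconv
  -- At a fixed (r,x) the flux relation is eventually exact, which identifies the limit of the
  -- fluxes.
  have hFae : ∀ x s t, ∀ᵐ r, r ∈ uIoc s t → F r x = b r x * (Ψ r (x + 1) - Ψ r x) := by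
    intro x s t
    obtain ⟨G, hG, hae⟩ := hdom' x s t
    filter_upwards [hae] with r hr hm
    refine tendsto_nhds_unique (hr hm).1 ?_
    refine Tendsto.congr' ?_ (((hΨ r (x + 1)).sub (hΨ r x)).const_mul (b r x))
    filter_upwards [hflux r x] with k hk using hk.symm
  refine ⟨Ψ, hΨ, fun x s t => ?_, fun x s t => ?_⟩
  · refine (hFint x s t).congr_ae ?_
    exact (ae_restrict_iff' measurableSet_uIoc).2 (hFae x s t)
  · rw [tendsto_nhds_unique ((hΨ t x).sub (hΨ s x)) (hlim x s t)]
    apply intervalIntegral.integral_congr_ae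
    filter_upwards [hFae x s t, hFae (x + -1) s t] with r h1 h2 hm
    rw [h1 hm, h2 hm, show x + -1 + 1 = x by ring]

/-- A nonnegative solution that vanishes at one point vanishes everywhere at later times. -/
theorem gradient_eq_zero_of_eq_zero {b Ψ : ℝ → ℤ → ℝ} (hb0 : ∀ t x, 0 < b t x)
    (hb : ∀ x s t, IntervalIntegrable (fun r => b r x) volume s t)
    (hbg : ∀ x s t, IntervalIntegrable (fun r => b r x * (Ψ r (x + 1) - Ψ r x)) volume s t)
    (heq : ∀ x s t, Ψ t x - Ψ s x = ∫ r in s..t,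
        (-(b r x * (Ψ r (x + 1) - Ψ r x)) + b r (x + -1) * (Ψ r x - Ψ r (x + -1))))
    (hpos : ∀ t x, 0 ≤ Ψ t (x + 1) - Ψ t x) {t₀ : ℝ} {x₀ : ℤ} (h0 : Ψ t₀ (x₀ + 1) - Ψ t₀ x₀ = 0)
    (t : ℝ) (ht : t₀ < t) (x : ℤ) : Ψ t (x + 1) - Ψ t x = 0 := by
  set q : ℝ → ℤ → ℝ := fun r x => b r x * (Ψ r (x + 1) - Ψ r x) with hq
  have hq0 : ∀ r x, 0 ≤ q r x := fun r x => mul_nonneg (hb0 r x).le (hpos r x)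
  have heq' : ∀ x s t, Ψ t x - Ψ s x = ∫ r in s..t, (-(q r x) + q r (x + -1)) := fun x s t => by
    rw [heq x s t]
    simp only [hq]
    congr 1; funext r
    rw [show x + -1 + 1 = x by ring]
  have hΨc : ∀ x, Continuous fun t => Ψ t x := fun x =>
    continuous_of_primitive (fun s t => (hbg x s t).neg.add (hbg (x + -1) s t))
      (fun s t => heq' x s t)
  have hg : ∀ x s t, (Ψ t (x + 1) - Ψ t x) - (Ψ s (x + 1) - Ψ s x)
      = 2 * (∫ r in s..t, q r x) - (∫ r in s..t, q r (x + 1)) - ∫ r in s..t, q r (x + -1) := by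
    intro x s t
    have e1 := heq' (x + 1) s t
    have e2 := heq' x s t
    have hn : ∀ y, IntervalIntegrable (fun r => -q r y) volume s t := fun y => (hbg y s t).neg
    rw [intervalIntegral.integral_add (hn _) (hbg _ s t), intervalIntegral.integral_neg] at e1 e2
    rw [show x + 1 + -1 = x by ring] at e1
    linarith
  -- Dropping the two nonnegative neighbour fluxes leaves g' ≤ 2bg for the gradient g.
  have hprop : ∀ x s t, s ≤ t → Ψ s (x + 1) - Ψ s x = 0 → Ψ t (x + 1) - Ψ t x = 0 := by
    intro x s t hst h
    refine eq_zero_of_integral_le (g := fun t => Ψ t (x + 1) - Ψ t x) (b := fun t => 2 * b t x)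
      ((hΨc (x + 1)).sub (hΨc x)) (fun t => hpos t x) (fun t => by linarith [hb0 t x])
      (fun s t => (hb x s t).const_mul 2) (fun s t hst => ?_) h hst
    have n1 := intervalIntegral.integral_nonneg (μ := volume) (f := fun r => q r (x + 1)) hst
      (fun r _ => hq0 r _)
    have n2 := intervalIntegral.integral_nonneg (μ := volume) (f := fun r => q r (x + -1)) hst
      (fun r _ => hq0 r _)
    have e : ∫ r in s..t, 2 * b r x * (Ψ r (x + 1) - Ψ r x) = 2 * ∫ r in s..t, q r x := by
      rw [← intervalIntegral.integral_const_mul]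
      congr 1; funext r
      simp only [hq]; ring
    rw [e]
    linarith [hg x s t]
  -- If the gradient at y were positive at t₁, it would be positive at all earlier times by `hprop`.
  -- The flux at y would then strictly decrease the gradient at x, which is identically zero after
  -- t₀.
  have hstep : ∀ x y, (y = x + 1 ∨ y = x + -1) →
      (∀ t, t₀ < t → Ψ t (x + 1) - Ψ t x = 0) → ∀ t, t₀ < t → Ψ t (y + 1) - Ψ t y = 0 := by
    intro x y hy hx t₁ ht₁
    by_contra hne
    have hy0 : ∀ r, r ≤ t₁ → 0 < q r y := fun r hr =>
      mul_pos (hb0 r y) (lt_of_le_of_ne (hpos r y) fun h => hne (hprop y r t₁ hr h.symm))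
    set s := (t₀ + t₁) / 2 with hs
    have hst : s < t₁ := by rw [hs]; linarith
    have hs0 : t₀ < s := by rw [hs]; linarith
    have p1 : 0 < ∫ r in s..t₁, q r y :=
      intervalIntegral.intervalIntegral_pos_of_pos_on (hbg y s t₁) (fun r hr => hy0 r hr.2.le) hst
    have n1 := intervalIntegral.integral_nonneg (μ := volume) (f := fun r => q r (x + 1)) hst.le
      (fun r _ => hq0 r _)
    have n2 := intervalIntegral.integral_nonneg (μ := volume) (f := fun r => q r (x + -1)) hst.le
      (fun r _ => hq0 r _)
    have z : ∫ r in s..t₁, q r x = 0 := by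
      rw [intervalIntegral.integral_congr (g := fun _ => (0 : ℝ)) (fun r hr => ?_)]
      · simp
      · rw [uIcc_of_le hst.le] at hr
        simp only [hq, hx r (hs0.trans_le hr.1), mul_zero]
    have := hg x s t₁
    rw [hx t₁ ht₁, hx s hs0, z] at this
    rcases hy with rfl | rfl <;> linarith
  have hall : ∀ n : ℤ, ∀ t, t₀ < t → Ψ t (x₀ + n + 1) - Ψ t (x₀ + n) = 0 := by
    intro n
    induction n using Int.induction_on with
    | zero => intro t ht; simpa using hprop x₀ t₀ t ht.le h0
    | succ n ih => exact hstep _ _ (Or.inl (by ring)) ih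
    | pred n ih => exact hstep _ _ (Or.inr (by ring)) ih
  have := hall (x - x₀) t ht
  rwa [show x₀ + (x - x₀) = x by ring] at this

end

/-! ### Parabolic coordinates: convergence, moments and strict positivity -/

section

variable {Ω : Type*}

/-- The approximate parabolic coordinates, normalized at the space-time origin. -/
def coordinateSeq (φ : ℕ → ℝ → ℤ → Ω → ℝ) (k : ℕ) (t : ℝ) (x : ℤ) (ω : Ω) : ℝ :=
  x + φ k t x ω - φ k 0 0 ω

/-- The parabolic coordinates. -/
noncomputable def coordinate (φ : ℕ → ℝ → ℤ → Ω → ℝ) (t : ℝ) (x : ℤ) (ω : Ω) : ℝ :=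
  limsup (fun k => coordinateSeq φ k t x ω) atTop

theorem coordinateSeq_sub (φ : ℕ → ℝ → ℤ → Ω → ℝ) (k : ℕ) (t : ℝ) (x : ℤ) (ω : Ω) :
    coordinateSeq φ k t (x + 1) ω - coordinateSeq φ k t x ω = tiltedGradient (φ k) t x ω := by
  simp only [coordinateSeq, tiltedGradient]
  push_cast
  ring

theorem coordinate_zero (φ : ℕ → ℝ → ℤ → Ω → ℝ) (ω : Ω) : coordinate φ 0 0 ω = 0 := by
  simp [coordinate, coordinateSeq]

/-- Samples along which the approximations converge to a solution of the parabolic equation. -/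
def IsGoodSample (b : ℝ → ℤ → Ω → ℝ) (φ : ℕ → ℝ → ℤ → Ω → ℝ) (ω : Ω) : Prop :=
  (∀ t x, Tendsto (fun k => coordinateSeq φ k t x ω) atTop (𝓝 (coordinate φ t x ω))) ∧
  (∀ x s t, IntervalIntegrable
    (fun r => b r x ω * (coordinate φ r (x + 1) ω - coordinate φ r x ω)) volume s t) ∧
  ∀ x s t, coordinate φ t x ω - coordinate φ s x ω = ∫ r in s..t,
    (-(b r x ω * (coordinate φ r (x + 1) ω - coordinate φ r x ω))
      + b r (x + -1) ω * (coordinate φ r x ω - coordinate φ r (x + -1) ω))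

variable [MeasurableSpace Ω] {P : Measure Ω} {b : ℝ → ℤ → Ω → ℝ} {τ : ℝ → ℤ → Ω → Ω}

section Stationary

variable {F : ℕ → ℝ → ℤ → Ω → ℝ}

theorem isGeometricCauchy_stationary (hτ : ∀ t x, MeasurePreserving (τ t x) P P)
    (hF : ∀ k, IsStationaryField b τ (F k)) (h : IsGeometricCauchy P fun k => F k 0 0)
    (t : ℝ) (x : ℤ) : IsGeometricCauchy P fun k => F k t x := by
  refine ⟨fun k => (hF k).integrable hτ (h.1 k) t x, h.2.imp fun C hC k => ?_⟩
  exact ((((hF (k + 1)).sub (hF k)).map (h := fun y => |y|) measurable_norm).integral_eq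
    hτ t x).trans_le (hC k)

/-- By stationarity the L¹ distance is the same at every time, so integrating over a bounded time
window only multiplies the constant by its length. -/
theorem isGeometricCauchy_prod [SFinite P] (hτ : ∀ t x, MeasurePreserving (τ t x) P P)
    (hF : ∀ k, IsStationaryField b τ (F k)) (h : IsGeometricCauchy P fun k => F k 0 0)
    {s t : ℝ} (hst : s ≤ t) (x : ℤ) :
    IsGeometricCauchy (P.prod (volume.restrict (Ioc s t))) fun k p => F k p.2 x p.1 := by
  obtain ⟨hi, C, hC⟩ := h
  refine ⟨fun k => ((hF k).integrable_prod hτ (hi k) s t x).swap, (t - s) * C, fun k => ?_⟩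
  have hD := ((hF (k + 1)).sub (hF k)).map (h := fun y => |y|) measurable_norm
  have hDi : Integrable (fun ω => |F (k + 1) 0 0 ω - F k 0 0 ω|) P := ((hi (k + 1)).sub (hi k)).abs
  have e := hD.integral_intervalIntegral hτ hDi hst x
  rw [integral_prod (fun p : Ω × ℝ => |F (k + 1) p.2 x p.1 - F k p.2 x p.1|)
    (hD.integrable_prod hτ hDi s t x).swap]
  simp_rw [intervalIntegral.integral_of_le hst] at e
  simp only
  rw [e, mul_assoc]
  exact mul_le_mul_of_nonneg_left (hC k) (sub_nonneg.2 hst)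

theorem isGeometricCauchy_intervalIntegral [SFinite P]
    (hτ : ∀ t x, MeasurePreserving (τ t x) P P)
    (hF : ∀ k, IsStationaryField b τ (F k)) (hii : ∀ k x ω s t,
      IntervalIntegrable (fun r => F k r x ω) volume s t)
    (h : IsGeometricCauchy P fun k => F k 0 0) (s t : ℝ) (x : ℤ) :
    IsGeometricCauchy P fun k ω => ∫ r in s..t, F k r x ω := by
  wlog hst : s ≤ t generalizing s t
  · simp_rw [intervalIntegral.integral_symm t s]
    exact (this t s (le_of_not_ge hst)).neg
  obtain ⟨hi, C, hC⟩ := isGeometricCauchy_prod hτ hF h hst x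
  refine ⟨fun k => ?_, C, fun k => le_trans ?_ (hC k)⟩
  · simp_rw [intervalIntegral.integral_of_le hst]
    exact (hi k).integral_prod_left
  · have hDi := ((hi (k + 1)).sub (hi k)).abs
    have hDi' : Integrable (fun p : Ω × ℝ => |F (k + 1) p.2 x p.1 - F k p.2 x p.1|)
      (P.prod (volume.restrict (Ioc s t))) := hDi
    rw [integral_prod _ hDi']
    refine integral_mono_of_nonneg (Eventually.of_forall fun ω => abs_nonneg _)
      hDi'.integral_prod_left (Eventually.of_forall fun ω => ?_)
    simp only
    rw [← intervalIntegral.integral_sub (hii _ _ _ _ _) (hii _ _ _ _ _),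
      intervalIntegral.integral_of_le hst]
    exact abs_integral_le_integral_abs

end Stationary

/-- Approximate correctors converging geometrically in `L¹`. -/
structure IsApproximation (P : Measure Ω) (b : ℝ → ℤ → Ω → ℝ) (τ : ℝ → ℤ → Ω → Ω)
    (φ f e : ℕ → ℝ → ℤ → Ω → ℝ) : Prop where
  approx : ∀ k, IsApproxCorrector P b τ k (φ k) (f k) (e k)
  gradient_cauchy : IsGeometricCauchy P fun k => tiltedGradient (φ k) 0 0
  flux_cauchy : IsGeometricCauchy P fun k => f k 0 0
  error_small : ∃ C : ℝ, 0 ≤ C ∧ ∀ k, ∫ ω, |e k 0 0 ω| ∂P ≤ C * (1 / 2) ^ k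

variable {φ f e : ℕ → ℝ → ℤ → Ω → ℝ}

theorem IsApproximation.coordinateSeq_cauchy_space (env : IsEnvironment P b τ)
    (h : IsApproximation P b τ φ f e) (x : ℤ) :
    IsGeometricCauchy P fun k => coordinateSeq φ k 0 x := by
  have hg := fun y => isGeometricCauchy_stationary env.invariant
    (fun k => (h.approx k).stationary.tiltedGradient) h.gradient_cauchy 0 y
  induction x using Int.induction_on with
  | zero =>
    have : (fun k => coordinateSeq φ k 0 0) = fun _ (_ : Ω) => (0 : ℝ) := by
      funext k ω; simp [coordinateSeq]
    rw [this]
    exact ⟨fun k => integrable_zero _ _ _, 0, fun k => by simp⟩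
  | succ n ih =>
    convert ih.add (hg n) using 3 with k ω
    rw [← coordinateSeq_sub]; ring
  | pred n ih =>
    convert ih.sub (hg (-n - 1)) using 3 with k ω
    rw [← coordinateSeq_sub]; simp

theorem IsApproximation.equation (h : IsApproximation P b τ φ f e) (k : ℕ) (s t : ℝ) (x : ℤ)
    (ω : Ω) : coordinateSeq φ k t x ω - coordinateSeq φ k s x ω
      = ∫ r in s..t, (e k r x ω - f k r x ω + f k r (x + -1) ω) := by
  rw [← (h.approx k).equation]
  simp only [coordinateSeq]; ring

theorem IsApproximation.measurable_coordinate (h : IsApproximation P b τ φ f e) (x : ℤ) :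
    Measurable fun p : ℝ × Ω => coordinate φ p.1 x p.2 := by
  refine Measurable.limsup fun k => ?_
  exact (((h.approx k).stationary.measurable x).const_add _).sub
    (((h.approx k).stationary.measurable_at 0 0).comp measurable_snd)

theorem IsApproximation.measurable_coordinate_at (h : IsApproximation P b τ φ f e) (t : ℝ) (x : ℤ) :
    Measurable (coordinate φ t x) := by
  refine Measurable.limsup fun k => ?_
  exact (((h.approx k).stationary.measurable_at t x).const_add _).sub
    ((h.approx k).stationary.measurable_at 0 0)

/-- The approximations satisfy the cocycle identity exactly for every ω. The right-hand side is
therefore the limsup of a sequence that already converges at ω, and τ t x ω itself need not be a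
good sample: one null set serves all shifts. -/
theorem IsApproximation.cocycle (h : IsApproximation P b τ φ f e) {ω : Ω}
    (hω : IsGoodSample b φ ω) (t s : ℝ) (x y : ℤ) :
    coordinate φ (t + s) (x + y) ω - coordinate φ t x ω = coordinate φ s y (τ t x ω) := by
  have hlim := (hω.1 (t + s) (x + y)).sub (hω.1 t x)
  rw [← hlim.limsup_eq, coordinate]
  congr 1; funext k
  simp only [coordinateSeq, (h.approx k).stationary.shift, zero_add]
  rw [add_comm s t, add_comm y x]
  push_cast
  ring

theorem IsApproximation.gradient_nonneg (h : IsApproximation P b τ φ f e) {ω : Ω}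
    (hω : IsGoodSample b φ ω) (t : ℝ) (x : ℤ) :
    0 ≤ coordinate φ t (x + 1) ω - coordinate φ t x ω := by
  refine ge_of_tendsto' ((hω.1 t (x + 1)).sub (hω.1 t x)) fun k => ?_
  rw [coordinateSeq_sub]
  exact (h.approx k).nonneg t x ω

theorem IsApproximation.factor (h : IsApproximation P b τ φ f e) (ω ω' : Ω)
    (hb : ∀ t x, b t x ω = b t x ω') (t : ℝ) (x : ℤ) :
    coordinate φ t x ω = coordinate φ t x ω' := by
  unfold coordinate
  congr 1; funext k
  simp only [coordinateSeq, (h.approx k).stationary.factor ω ω' hb]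

/-- The event that the gradients of the approximations eventually vanish in the limit. -/
def extinctionEvent (φ : ℕ → ℝ → ℤ → Ω → ℝ) : Set Ω :=
  {ω | ∃ N : ℕ, ∀ x : ℤ, ∀ᵐ r ∂(volume : Measure ℝ), (N : ℝ) ≤ r →
    Tendsto (fun k => tiltedGradient (φ k) r x ω) atTop (𝓝 0)}

/-- An intersection over uncountably many times could fail to be measurable. Asking only for almost
every r expresses the event through sections of Lebesgue measure zero, which are measurable by
Fubini. -/
theorem IsApproximation.measurableSet_extinctionEvent (h : IsApproximation P b τ φ f e) :
    MeasurableSet (extinctionEvent φ) := by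
  have e : extinctionEvent φ = ⋃ N : ℕ, ⋂ x : ℤ, {ω | ∀ᵐ r ∂(volume : Measure ℝ), (N : ℝ) ≤ r →
    Tendsto (fun k => tiltedGradient (φ k) r x ω) atTop (𝓝 0)} := by
    ext ω; simp [extinctionEvent]
  rw [e]
  refine MeasurableSet.iUnion fun N => MeasurableSet.iInter fun x => ?_
  have hS : MeasurableSet {p : Ω × ℝ | (N : ℝ) ≤ p.2 →
      Tendsto (fun k => tiltedGradient (φ k) p.2 x p.1) atTop (𝓝 0)} := by
    have h1 : MeasurableSet {p : Ω × ℝ | (N : ℝ) ≤ p.2} :=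
      measurableSet_le measurable_const measurable_snd
    have h2 : MeasurableSet {p : Ω × ℝ |
        Tendsto (fun k => tiltedGradient (φ k) p.2 x p.1) atTop (𝓝 0)} :=
      measurableSet_tendsto (𝓝 0) fun k =>
        ((h.approx k).stationary.tiltedGradient.measurable x).comp measurable_swap
    exact h1.imp h2
  have hz := measurable_measure_prodMk_left (ν := (volume : Measure ℝ)) hS.compl
  exact hz (measurableSet_singleton 0)

/-- Since the event speaks of the approximate gradients, which move with the shifts for every ω, the
invariance is exact, as ergodicity demands, and not merely almost sure. -/
theorem IsApproximation.shift_mem_extinctionEvent (h : IsApproximation P b τ φ f e) {ω : Ω}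
    (hω : ω ∈ extinctionEvent φ) (s : ℝ) (y : ℤ) : τ s y ω ∈ extinctionEvent φ := by
  obtain ⟨N, hN⟩ := hω
  obtain ⟨N', hN'⟩ := exists_nat_ge (N - s)
  refine ⟨N', fun x => ?_⟩
  have := (measurePreserving_add_right volume s).quasiMeasurePreserving.ae (hN (x + y))
  filter_upwards [this] with r hr hle
  simp_rw [fun k => (h.approx k).stationary.tiltedGradient.shift r s x y ω]
  exact hr (by linarith)

theorem IsApproximation.gradient_pos (env : IsEnvironment P b τ)
    (h : IsApproximation P b τ φ f e) {ω : Ω} (hω : IsGoodSample b φ ω)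
    (hb : ∀ x s t, IntervalIntegrable (fun r => b r x ω) volume s t)
    (hA : ω ∉ extinctionEvent φ) (t : ℝ) (x : ℤ) :
    0 < coordinate φ t (x + 1) ω - coordinate φ t x ω := by
  refine lt_of_le_of_ne (h.gradient_nonneg hω t x) fun h0 => hA ?_
  obtain ⟨N, hN⟩ := exists_nat_gt t
  refine ⟨N, fun y => Eventually.of_forall fun r hr => ?_⟩
  have hz := gradient_eq_zero_of_eq_zero (b := fun t x => b t x ω)
    (Ψ := fun t x => coordinate φ t x ω) (fun t x => env.pos t x ω) hb hω.2.1 hω.2.2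
    (fun t x => h.gradient_nonneg hω t x) h0.symm r (hN.trans_le hr) y
  have := (hω.1 r (y + 1)).sub (hω.1 r y)
  rw [hz] at this
  simpa only [coordinateSeq_sub] using this

section Probability

variable [IsProbabilityMeasure P]

theorem IsEnvironment.exists_isApproximation (env : IsEnvironment P b τ) :
    ∃ φ f e, IsApproximation P b τ φ f e := by
  obtain ⟨C, φ, f, e, h, h1, h2, h3⟩ := env.exists_approximation
  refine ⟨φ, f, e, h, ⟨fun k => ?_, C, h1⟩, ⟨fun k => ?_, C, h2⟩, C, ?_, h3⟩
  · obtain ⟨M, hM⟩ := (h k).bounded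
    exact (h k).stationary.tiltedGradient.integrable_of_bounded (abs_tiltedGradient_le hM) 0 0
  · obtain ⟨M, hM⟩ := (h k).bounded_flux
    exact (h k).stationary_flux.integrable_of_bounded hM 0 0
  · have h0 : 0 ≤ ∫ ω, |e 0 0 0 ω| ∂P := integral_nonneg fun ω => abs_nonneg _
    simpa using h0.trans (h3 0)

theorem IsApproximation.integrable_error (h : IsApproximation P b τ φ f e) (k : ℕ) :
    Integrable (e k 0 0) P := by
  obtain ⟨M, hM⟩ := (h.approx k).bounded_error
  exact (h.approx k).stationary_error.integrable_of_bounded hM 0 0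

/-- Space increments are sums of gradients, time increments are integrals of fluxes and errors; all
of these are geometrically Cauchy. -/
theorem IsApproximation.coordinateSeq_cauchy (env : IsEnvironment P b τ)
    (h : IsApproximation P b τ φ f e) (t : ℝ) (x : ℤ) :
    IsGeometricCauchy P fun k => coordinateSeq φ k t x := by
  obtain ⟨C, hC0, hC⟩ := h.error_small
  have he := isGeometricCauchy_of_le h.integrable_error hC0 hC
  have hf' := isGeometricCauchy_stationary env.invariant
    (fun k => (h.approx k).stationary_flux) h.flux_cauchy 0 (0 + -1)
  have hst : ∀ k, IsStationaryField b τ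
      (fun t x ω => e k t x ω - f k t x ω + f k t (x + -1) ω) := fun k =>
    ((h.approx k).stationary_error.sub (h.approx k).stationary_flux).add
      ((h.approx k).stationary_flux.translate (-1))
  have hii : ∀ k x ω s t, IntervalIntegrable
      (fun r => e k r x ω - f k r x ω + f k r (x + -1) ω) volume s t := fun k x ω s t =>
    (((h.approx k).intervalIntegrable x ω s t).2.sub
      ((h.approx k).intervalIntegrable x ω s t).1).add
      ((h.approx k).intervalIntegrable (x + -1) ω s t).1
  have := (h.coordinateSeq_cauchy_space env x).add
    (isGeometricCauchy_intervalIntegral env.invariant hst hii ((he.sub h.flux_cauchy).add hf') 0 t x)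
  convert this using 3 with k ω
  rw [← h.equation]; ring

theorem IsApproximation.ae_dominated (env : IsEnvironment P b τ)
    (h : IsApproximation P b τ φ f e) : ∀ᵐ ω ∂P, ∀ (x : ℤ) (T : ℕ), ∃ G : ℝ → ℝ,
      IntegrableOn G (Ioc (-T : ℝ) T) ∧
      ∀ᵐ r ∂volume.restrict (Ioc (-T : ℝ) T), (∃ y, Tendsto (fun k => f k r x ω) atTop (𝓝 y)) ∧
        Tendsto (fun k => e k r x ω) atTop (𝓝 0) ∧ ∀ k, |f k r x ω| ≤ G r ∧ |e k r x ω| ≤ G r := by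
  rw [ae_all_iff]; intro x
  rw [ae_all_iff]; intro T
  have hT : (-T : ℝ) ≤ T := by linarith [T.cast_nonneg (α := ℝ)]
  obtain ⟨C, hC0, hC⟩ := h.error_small
  have hfp := isGeometricCauchy_prod env.invariant (fun k => (h.approx k).stationary_flux)
    h.flux_cauchy hT x
  obtain ⟨G₁, hG₁, hae₁⟩ := exists_integrable_bound_of_geometric_cauchy hfp.1 hfp.2.choose_spec
  have hei : ∀ k, Integrable (fun p : Ω × ℝ => e k p.2 x p.1)
      (P.prod (volume.restrict (Ioc (-T : ℝ) T))) := fun k =>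
    ((h.approx k).stationary_error.integrable_prod env.invariant (h.integrable_error k) _ _ x).swap
  obtain ⟨G₂, hG₂, hae₂⟩ := exists_integrable_tsum_of_geometric hei
    (C := ((T : ℝ) - -T) * C) (fun k => by
      have hst := (h.approx k).stationary_error.map (h := fun y => |y|) measurable_norm
      have hi : Integrable (fun ω => |e k 0 0 ω|) P := (h.integrable_error k).abs
      have e1 := hst.integral_intervalIntegral env.invariant hi hT x
      rw [integral_prod (fun p : Ω × ℝ => |e k p.2 x p.1|) (hei k).abs]
      simp_rw [intervalIntegral.integral_of_le hT] at e1
      simp only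
      rw [e1, mul_assoc]
      exact mul_le_mul_of_nonneg_left (hC k) (sub_nonneg.2 hT))
  filter_upwards [hG₁.prod_right_ae, hG₂.prod_right_ae, Measure.ae_ae_of_ae_prod hae₁,
    Measure.ae_ae_of_ae_prod hae₂] with ω i1 i2 a1 a2
  refine ⟨fun r => |G₁ (ω, r)| + |G₂ (ω, r)|, i1.abs.add i2.abs, ?_⟩
  filter_upwards [a1, a2] with r h1 h2
  refine ⟨h1.1, ?_, fun k => ⟨?_, ?_⟩⟩
  · exact (tendsto_zero_iff_abs_tendsto_zero _).2 h2.1.tendsto_atTop_zero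
  · exact (h1.2 k).trans ((le_abs_self _).trans (le_add_of_nonneg_right (abs_nonneg _)))
  · refine le_trans ?_ ((le_abs_self _).trans (le_add_of_nonneg_left (abs_nonneg _)))
    rw [← h2.2]
    exact h2.1.le_tsum k (fun _ _ => abs_nonneg _)

theorem IsApproximation.ae_isGoodSample (env : IsEnvironment P b τ)
    (h : IsApproximation P b τ φ f e) : ∀ᵐ ω ∂P, IsGoodSample b φ ω := by
  have h0 : ∀ᵐ ω ∂P, ∀ x : ℤ, ∃ y, Tendsto (fun k => coordinateSeq φ k 0 x ω) atTop (𝓝 y) := by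
    rw [ae_all_iff]; intro x
    have hc := h.coordinateSeq_cauchy_space env x
    obtain ⟨G, -, hae⟩ := exists_integrable_bound_of_geometric_cauchy hc.1 hc.2.choose_spec
    filter_upwards [hae] with ω hω using hω.1
  filter_upwards [h.ae_dominated env, h0] with ω hdom h0
  obtain ⟨Ψ, hΨ, hint, heq⟩ := exists_limit_of_dominated (b := fun t x => b t x ω)
    (ψ := fun k t x => coordinateSeq φ k t x ω) (f := fun k t x => f k t x ω)
    (e := fun k t x => e k t x ω) (fun k s t x => h.equation k s t x ω)
    (fun k x => (h.approx k).stationary_flux.measurable_path x ω)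
    (fun k x => (h.approx k).stationary_error.measurable_path x ω) hdom
    -- The flux relation is exact as soon as k exceeds the conductance b r x ω.
    (fun r x => by
      obtain ⟨K, hK⟩ := exists_nat_ge (b r x ω)
      filter_upwards [eventually_ge_atTop K] with k hk
      rw [coordinateSeq_sub]
      exact (h.approx k).flux_eq r x ω (hK.trans (by exact_mod_cast hk))) h0
  have e : ∀ t x, Ψ t x = coordinate φ t x ω := fun t x => (hΨ t x).limsup_eq.symm
  simp only [e] at hΨ hint heq
  exact ⟨hΨ, hint, heq⟩

theorem IsApproximation.integrable_and_integral (env : IsEnvironment P b τ)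
    (h : IsApproximation P b τ φ f e) (t : ℝ) (x : ℤ) :
    Integrable (coordinate φ t x) P ∧ ∫ ω, coordinate φ t x ω ∂P = x := by
  have hc := h.coordinateSeq_cauchy env t x
  obtain ⟨G, hG, hae⟩ := exists_integrable_bound_of_geometric_cauchy hc.1 hc.2.choose_spec
  have hgood := h.ae_isGoodSample env
  have hbound : ∀ k, ∀ᵐ ω ∂P, ‖coordinateSeq φ k t x ω‖ ≤ G ω := fun k => by
    filter_upwards [hae] with ω hω using hω.2 k
  have hlim : ∀ᵐ ω ∂P, Tendsto (fun k => coordinateSeq φ k t x ω) atTop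
      (𝓝 (coordinate φ t x ω)) := by
    filter_upwards [hgood] with ω hω using hω.1 t x
  constructor
  · refine hG.mono' (aestronglyMeasurable_of_tendsto_ae atTop (fun k => (hc.1 k).1) hlim) ?_
    filter_upwards [hae, hlim] with ω h1 h2 using le_of_tendsto' h2.norm h1.2
  · refine tendsto_nhds_unique (tendsto_integral_of_dominated_convergence G (fun k => (hc.1 k).1)
      hG hbound hlim) ?_
    -- The bounded corrector has the same mean at (t,x) and at (0,0), so it cancels.
    have : ∀ k, ∫ ω, coordinateSeq φ k t x ω ∂P = x := fun k => by
      obtain ⟨M, hM⟩ := (h.approx k).bounded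
      have i1 := (h.approx k).stationary.integrable_of_bounded (P := P) hM t x
      have i2 := (h.approx k).stationary.integrable_of_bounded (P := P) hM 0 0
      have i3 : Integrable (fun ω => (x : ℝ) + φ k t x ω) P := (integrable_const _).add i1
      simp only [coordinateSeq]
      rw [MeasureTheory.integral_sub i3 i2, MeasureTheory.integral_add (integrable_const _) i1,
        (h.approx k).stationary.integral_eq env.invariant t x]
      simp
    simp_rw [this]
    exact tendsto_const_nhds

/-- Fatou is applied to the flux energy b⁻¹f², which eventually equals bG² pointwise. The gradient
part of the pair energy would give only the weight min(b,1). -/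
theorem IsApproximation.integrable_energy (env : IsEnvironment P b τ)
    (h : IsApproximation P b τ φ f e) :
    Integrable (fun ω => b 0 0 ω * coordinate φ 0 1 ω ^ 2) P := by
  have hm := h.measurable_coordinate_at 0 1
  refine ⟨((env.stationary.measurable_at 0 0).mul (hm.pow_const 2)).aestronglyMeasurable, ?_⟩
  have hu : ∀ k, Measurable fun ω => (b 0 0 ω)⁻¹ * f k 0 0 ω ^ 2 := fun k =>
    (env.stationary.measurable_at 0 0).inv.mul
      (((h.approx k).stationary_flux.measurable_at 0 0).pow_const 2)
  have hlim : ∀ᵐ ω ∂P, Tendsto (fun k => (b 0 0 ω)⁻¹ * f k 0 0 ω ^ 2) atTop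
      (𝓝 (b 0 0 ω * coordinate φ 0 1 ω ^ 2)) := by
    filter_upwards [h.ae_isGoodSample env] with ω hω
    have h1 := (hω.1 0 1).pow 2 |>.const_mul (b 0 0 ω)
    refine Tendsto.congr' ?_ h1
    obtain ⟨K, hK⟩ := exists_nat_ge (b 0 0 ω)
    filter_upwards [eventually_ge_atTop K] with k hk
    have hg := coordinateSeq_sub φ k 0 0 ω
    have hz : coordinateSeq φ k 0 0 ω = 0 := by simp [coordinateSeq]
    rw [hz, zero_add, sub_zero] at hg
    rw [(h.approx k).flux_eq 0 0 ω (hK.trans (by exact_mod_cast hk)), hg]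
    have := (env.pos 0 0 ω).ne'
    field_simp
  have hB : ∀ k, ∫⁻ ω, ‖(b 0 0 ω)⁻¹ * f k 0 0 ω ^ 2‖ₑ ∂P
      ≤ ENNReal.ofReal (2 * ∫ ω, b 0 0 ω ∂P) := fun k => by
    obtain ⟨M, hM⟩ := (h.approx k).bounded_flux
    have hi := env.integrable_inv_mul_sq ((h.approx k).stationary_flux.measurable_at 0 0) (hM 0 0)
    rw [← ofReal_integral_norm_eq_lintegral_enorm hi]
    apply ENNReal.ofReal_le_ofReal
    refine le_trans ?_ (h.approx k).energy_le
    refine integral_mono hi.norm ((h.approx k).integrable_energy env) fun ω => ?_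
    have hb := env.pos 0 0 ω
    have h2 : 0 ≤ min (b 0 0 ω) 1 := le_min hb.le zero_le_one
    simp only
    rw [Real.norm_eq_abs, abs_of_nonneg (by positivity)]
    exact le_add_of_nonneg_left (by positivity)
  calc ∫⁻ ω, ‖b 0 0 ω * coordinate φ 0 1 ω ^ 2‖ₑ ∂P
      = ∫⁻ ω, liminf (fun k => ‖(b 0 0 ω)⁻¹ * f k 0 0 ω ^ 2‖ₑ) atTop ∂P := by
        refine lintegral_congr_ae ?_
        filter_upwards [hlim] with ω hω using hω.enorm.liminf_eq.symm
    _ ≤ liminf (fun k => ∫⁻ ω, ‖(b 0 0 ω)⁻¹ * f k 0 0 ω ^ 2‖ₑ ∂P) atTop :=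
        lintegral_liminf_le fun k => (hu k).enorm
    _ ≤ ENNReal.ofReal (2 * ∫ ω, b 0 0 ω ∂P) :=
        (liminf_le_liminf (Eventually.of_forall hB)).trans (by simp)
    _ < ⊤ := ENNReal.ofReal_lt_top

/-- Almost surely on the whole space the gradients cannot become extinct. -/
theorem IsApproximation.not_ae_extinctionEvent (env : IsEnvironment P b τ)
    (h : IsApproximation P b τ φ f e)
    (hb : ∀ ω x s t, IntervalIntegrable (fun r => b r x ω) volume s t) :
    ¬ ∀ᵐ ω ∂P, ω ∈ extinctionEvent φ := by
  intro hA
  have hgood := h.ae_isGoodSample env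
  have hm := h.measurable_coordinate_at 0 1
  -- Truncating at 1 allows bounded convergence as m → ∞, while stationarity keeps the integral
  -- constant in m.
  have hst : ∀ m : ℕ, ∫ ω, min |coordinate φ m 1 ω - coordinate φ m 0 ω| 1 ∂P
      = ∫ ω, min |coordinate φ 0 1 ω| 1 ∂P := fun m => by
    have e1 : ∫ ω, min |coordinate φ m 1 ω - coordinate φ m 0 ω| 1 ∂P
        = ∫ ω, min |coordinate φ 0 1 (τ m 0 ω)| 1 ∂P := by
      refine integral_congr_ae ?_
      filter_upwards [hgood] with ω hω
      have := h.cocycle hω m 0 0 1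
      simp only [add_zero, zero_add] at this
      rw [this]
    have e2 := integral_map (μ := P) (env.invariant m 0).measurable.aemeasurable
      (f := fun ω => min |coordinate φ 0 1 ω| 1)
      (hm.abs.min measurable_const).aestronglyMeasurable
    rw [(env.invariant m 0).map_eq] at e2
    rw [e1, e2]
  have hlim : Tendsto (fun m : ℕ => ∫ ω, min |coordinate φ m 1 ω - coordinate φ m 0 ω| 1 ∂P) atTop
      (𝓝 (∫ _, (0 : ℝ) ∂P)) := by
    refine tendsto_integral_of_dominated_convergence (fun _ => 1) (fun m => ?_)
      (integrable_const _) (fun m => Eventually.of_forall fun ω => ?_) ?_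
    · exact (((h.measurable_coordinate_at m 1).sub (h.measurable_coordinate_at m 0)).abs.min
        measurable_const).aestronglyMeasurable
    · rw [Real.norm_eq_abs, abs_of_nonneg (le_min (abs_nonneg _) zero_le_one)]
      exact min_le_right _ _
    · filter_upwards [hgood, hA] with ω hω ⟨N, hN⟩
      -- Extinction at almost every time after N provides one actual zero r₀ in (N, N + 1), and
      -- zeros propagate to all later times, in particular to every integer m > N + 1.
      obtain ⟨r₀, hr₀, hr₀N, hr₀z⟩ : ∃ r₀ : ℝ, (N : ℝ) < r₀ ∧ r₀ < N + 1 ∧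
          coordinate φ r₀ (0 + 1) ω - coordinate φ r₀ 0 ω = 0 := by
        have hfreq : ∃ᵐ r ∂(volume : Measure ℝ), r ∈ Ioo (N : ℝ) (N + 1) := by
          rw [frequently_ae_mem_iff]
          simp
        obtain ⟨r, hr, hr'⟩ := (hfreq.and_eventually (hN 0)).exists
        refine ⟨r, hr.1, hr.2, tendsto_nhds_unique ((hω.1 r (0 + 1)).sub (hω.1 r 0)) ?_⟩
        simp_rw [coordinateSeq_sub]
        exact hr' hr.1.le
      refine tendsto_const_nhds.congr' ?_
      filter_upwards [eventually_gt_atTop (N + 1)] with m hm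
      have hmr : r₀ < m := hr₀N.trans (by exact_mod_cast hm)
      have hz := gradient_eq_zero_of_eq_zero (b := fun t x => b t x ω)
        (Ψ := fun t x => coordinate φ t x ω) (fun t x => env.pos t x ω) (hb ω) hω.2.1 hω.2.2
        (fun t x => h.gradient_nonneg hω t x) hr₀z m hmr 0
      rw [zero_add] at hz
      rw [hz]
      simp
  simp_rw [hst] at hlim
  have hzero := tendsto_nhds_unique tendsto_const_nhds hlim
  rw [integral_zero, integral_eq_zero_iff_of_nonneg
    (fun ω => le_min (abs_nonneg _) zero_le_one)] at hzero
  · have h1 := (h.integrable_and_integral env 0 1).2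
    have h2 : ∫ ω, coordinate φ 0 1 ω ∂P = 0 := by
      refine (integral_congr_ae (g := fun _ => (0 : ℝ)) ?_).trans (by simp)
      filter_upwards [hzero] with ω hω
      simp only [Pi.zero_apply] at hω
      rcases min_choice |coordinate φ 0 1 ω| 1 with h' | h' <;> rw [h'] at hω
      · exact abs_eq_zero.1 hω
      · exact absurd hω one_ne_zero
    rw [h2] at h1
    norm_num at h1
  · refine Integrable.of_bound (hm.abs.min measurable_const).aestronglyMeasurable 1
      (Eventually.of_forall fun ω => ?_)
    rw [Real.norm_eq_abs, abs_of_nonneg (le_min (abs_nonneg _) zero_le_one)]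
    exact min_le_right _ _

end Probability

end

end ParabolicCoordinates

/-! ### The main theorem -/

open ParabolicCoordinates in
theorem mainTheorem2 {Ω : Type*} [MeasurableSpace Ω] (P : Measure Ω) [IsProbabilityMeasure P]
    (a : ℝ → ℤ → ℤ → Ω → ℝ) (τ : ℝ → ℤ → Ω → Ω)
    (hyp : IsStationaryErgodicConductance P a τ)
    (e : ℤ) (hupper : Integrable (fun ω => a 0 e (e + 1) ω) P)
    (hlower : Integrable (fun ω => (a 0 e (e + 1) ω)⁻¹) P) :
    ∃ ψ : ℝ → ℤ → Ω → ℝ,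
      -- `ψ` is a function of the sample of the conductances
      (∀ ω ω' : Ω, (∀ t x, a t x (x + 1) ω = a t x (x + 1) ω') → ∀ t x, ψ t x ω = ψ t x ω') ∧
      -- joint measurability in time and the environment
      (∀ x : ℤ, Measurable fun p : ℝ × Ω => ψ p.1 x p.2) ∧
      -- mean and weighted second moment
      (∀ (t : ℝ) (x : ℤ), Integrable (ψ t x) P ∧ ∫ ω, ψ t x ω ∂P = x) ∧
      Integrable (fun ω => a 0 0 1 ω * (ψ 0 1 ω) ^ 2) P ∧
      ∀ᵐ ω ∂P,
        -- parabolic equation, initial data and continuity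
        IsWeakParabolicSolution (fun t x y => a t x y ω) (fun t x => ψ t x ω) ∧
        ψ 0 0 ω = 0 ∧
        (∀ x : ℤ, Continuous fun t : ℝ => ψ t x ω) ∧
        -- cocycle condition
        (∀ (t s : ℝ) (x y : ℤ), ψ (t + s) (x + y) ω - ψ t x ω = ψ s y (τ t x ω)) ∧
        -- positivity of the spatial gradients
        (∀ (t : ℝ) (x : ℤ), 0 < ψ t (x + 1) ω - ψ t x ω) := by
  set b : ℝ → ℤ → Ω → ℝ := fun t x ω => a t x (x + 1) ω with hb_def
  have hb : IsStationaryField b τ b :=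
    ⟨hyp.measurable, fun t s x y ω => hyp.covariant t s x y ω, fun _ _ h t x => h t x⟩
  -- The moment assumptions at the edge e are moved to the origin by a measure-preserving shift.
  have hshift : ∀ ω, b 0 0 ω = b 0 e (τ 0 (-e) ω) := fun ω => by
    rw [hb.shift]; simp
  have env : IsEnvironment P b τ :=
    { stationary := hb
      pos := hyp.pos
      invariant := hyp.invariant
      integrable := by
        have := (hyp.invariant 0 (-e)).integrable_comp_of_integrable hupper
        exact this.congr (Filter.Eventually.of_forall fun ω => (hshift ω).symm)
      integrable_inv := by
        have := (hyp.invariant 0 (-e)).integrable_comp_of_integrable hlower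
        exact this.congr (Filter.Eventually.of_forall fun ω => by
          simp only [Function.comp]; exact congrArg _ (hshift ω).symm) }
  have hbi : ∀ ω x s t, IntervalIntegrable (fun r => b r x ω) volume s t := fun ω x s t =>
    (intervalIntegrable_iff' (by simp)).2 ((hyp.locallyIntegrable x ω).integrableOn_isCompact isCompact_uIcc)
  obtain ⟨φ, f, err, h⟩ := env.exists_isApproximation
  -- Forward invariance suffices, because the inverse of a shift is again a shift.
  have hinv : ∀ t x, τ t x ⁻¹' extinctionEvent φ = extinctionEvent φ := fun t x => by
    ext ω
    refine ⟨fun hω => ?_, fun hω => h.shift_mem_extinctionEvent hω t x⟩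
    have := h.shift_mem_extinctionEvent hω (-t) (-x)
    rwa [← hyp.shift_add, neg_add_cancel, neg_add_cancel, hyp.shift_zero] at this
  have hA0 : P (extinctionEvent φ) = 0 := by
    refine (hyp.ergodic _ h.measurableSet_extinctionEvent hinv).resolve_right fun h1 => ?_
    exact h.not_ae_extinctionEvent env hbi
      ((prob_compl_eq_zero_iff h.measurableSet_extinctionEvent).2 h1)
  refine ⟨coordinate φ, fun ω ω' hω => h.factor ω ω' hω, h.measurable_coordinate,
    h.integrable_and_integral env, h.integrable_energy env, ?_⟩
  filter_upwards [h.ae_isGoodSample env, measure_eq_zero_iff_ae_notMem.1 hA0] with ω hω hωA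
  have hgen : ∀ t x, nnGenerator (fun x y => a t x y ω) (fun x => coordinate φ t x ω) x
      = b t x ω * (coordinate φ t (x + 1) ω - coordinate φ t x ω)
        - b t (x + -1) ω * (coordinate φ t x ω - coordinate φ t (x + -1) ω) := fun t x => by
    have hs := hyp.symm t (x + -1) ω
    simp only [nnGenerator, hb_def]
    rw [Finset.sum_pair (by norm_num), hs, show x + -1 + 1 = x by ring]
    ring
  have hii : ∀ x s t, IntervalIntegrable (fun r =>
      -(b r x ω * (coordinate φ r (x + 1) ω - coordinate φ r x ω))
      + b r (x + -1) ω * (coordinate φ r x ω - coordinate φ r (x + -1) ω)) volume s t :=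
    fun x s t => by
      have h2 := hω.2.1 (x + -1) s t
      rw [show x + -1 + 1 = x by ring] at h2
      exact (hω.2.1 x s t).neg.add h2
  have hcont : ∀ x : ℤ, Continuous fun t : ℝ => coordinate φ t x ω := fun x =>
    continuous_of_primitive (hii x) (hω.2.2 x)
  refine ⟨fun x => ⟨(hcont x).locallyIntegrable, ?_, fun η hη hc => ?_⟩, coordinate_zero φ ω, hcont,
    fun t s x y => h.cocycle hω t s x y, fun t x => h.gradient_pos env hω (hbi ω) hωA t x⟩
  · intro t
    refine ⟨Set.Ioc (t - 1) (t + 1), Ioc_mem_nhds (by linarith) (by linarith), ?_⟩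
    have := (hii x (t - 1) (t + 1)).neg
    rw [intervalIntegrable_iff_integrableOn_Ioc_of_le (by linarith)] at this
    refine this.congr_fun (fun r _ => ?_) measurableSet_Ioc
    simp only [Pi.neg_apply]
    rw [hgen]; ring
  · rw [integral_mul_deriv_of_primitive (hii x) (hω.2.2 x) hη hc, neg_neg,
      add_eq_zero_iff_eq_neg, ← integral_neg]
    congr 1; funext t
    rw [hgen]; ring
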